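/- Let $p$ be a prime, $\Bbbk$ an algebraically closed field of characteristic $p$, $n\ge 1$, and $H=\Bbbk[C_p^n]^*$ the dual Hopf algebra of the group algebra of the elementary abelian group $C_p^n$. Let $A$ be a finite-dimensional commutative local $\Bbbk$-algebra. An $H$-cleft extension of $A$ is a right $H$-comodule algebra $B\supseteq A$ with $B^{\mathrm{co}H}=A$ that admits a convolution invertible right $H$-comodule map $H\to B$. Two $H$-cleft extensions $B,B'$ of $A$ are twist equivalent if there are an algebra automorphism $\varphi$ of $A$, a Hopf algebra automorphism $\phi$ of $H$ and an algebra isomorphism $f:B\to B'$ such that $f(ab)=\varphi(a)f(b)$ for $a\in A$, $b\in B$, and $(\mathrm{id}\otimes\phi)\rho'f=(f\otimes\mathrm{id})\rho$, where $\rho,\rho'$ are the coactions of $B,B'$. For an $H$-module algebra structure on $A$, the smash product $A\# H$ is $A\otimes H$ with the multiplication $(a\# h)(b\# l)=\sum a(h_1\cdot b)\# h_2l$ and the coaction $\mathrm{id}\otimes\Delta$. (1) Every $H$-cleft extension of $A$ is twist equivalent to a smash product $A\# H$ for some $H$-module algebra structure on $A$. (2) The Hopf algebra $H$ is generated as an algebra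 by a primitive element $x$ with $x^{p^n}=x$. Fix any such $x$, and suppose that $A$ is generated as a $\Bbbk$-algebra by a nilpotent element $t$ (that is, $A\cong\Bbbk[t]/(t^m)$ with $m=\dim_{\Bbbk} A$). Then each of the following determines a unique $H$-module algebra structure on $A$: $$\text{(a) } x\cdot t=0,\qquad \text{(b) } x\cdot t=t,\qquad \text{(c) } x\cdot t=t+1 \text{ (if } p\mid\dim A),$$ and an action as in (c) exists only if $p\mid\dim A$. Every $H$-cleft extension of $A$ is twist equivalent to the smash product for one of these actions. If $\dim A>1$, then the smash products for (a), (b) and (c) (the last one when it exists) are pairwise not twist equivalent. So there are exactly three twist equivalence classes if $p\mid\dim A$, and exactly two, those of (a) and (b), if $p\nmid\dim A$ and $\dim A>1$. -/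

import Mathlib

open scoped TensorProduct
open Coalgebra

universe u v w

noncomputable section

/-! ## The dual of a finite-dimensional Hopf algebra -/

section HopfDual

variable (k : Type u) [Field k] (K : Type v) [Ring K] [HopfAlgebra k K]

/-- The linear dual `K^*`. Its algebra structure is Mathlib's convolution product
`(f g)(a) = ∑ f(a₁) g(a₂)`, with unit the counit of `K`. -/
def HopfDual : Type (max u v) := WithConv (K →ₗ[k] k)

namespace HopfDual

instance : Ring (HopfDual k K) := inferInstanceAs (Ring (WithConv (K →ₗ[k] k)))

instance : Algebra k (HopfDual k K) := inferInstanceAs (Algebra k (WithConv (K →ₗ[k] k)))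

/-- The underlying linear form of an element of `K^*`. -/
def toDual : HopfDual k K ≃ₗ[k] (K →ₗ[k] k) where
  toFun f := WithConv.ofConv f
  invFun f := WithConv.toConv f
  left_inv _ := rfl
  right_inv _ := rfl
  map_add' _ _ := rfl
  map_smul' _ _ := rfl

variable {k K}

instance : CoeFun (HopfDual k K) (fun _ => K → k) := ⟨fun f => toDual k K f⟩

@[ext] lemma ext {f g : HopfDual k K} (h : ∀ a, f a = g a) : f = g :=
  (toDual k K).injective (LinearMap.ext h)

lemma one_apply (a : K) : (1 : HopfDual k K) a = counit (R := k) a := rfl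

lemma mul_apply {ι : Type*} {a : K} (r : Coalgebra.Repr k a ι) (f g : HopfDual k K) :
    (f * g) a = ∑ i ∈ r.index, f (r.left i) * g (r.right i) :=
  r.convMul_apply (WithConv.toConv (toDual k K f)) (WithConv.toConv (toDual k K g))

/-- Evaluation at `a`. -/
def ev (a : K) : HopfDual k K →ₗ[k] k :=
  (LinearMap.applyₗ a : (K →ₗ[k] k) →ₗ[k] k) ∘ₗ (toDual k K).toLinearMap

@[simp] lemma ev_apply (a : K) (f : HopfDual k K) : ev a f = f a := rfl

/-- The pairing of `K^* ⊗ K^*` with `a ⊗ b`. -/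
def pair (a b : K) : HopfDual k K ⊗[k] HopfDual k K →ₗ[k] k :=
  LinearMap.mul' k k ∘ₗ TensorProduct.map (ev a) (ev b)

@[simp] lemma pair_tmul (a b : K) (f g : HopfDual k K) : pair a b (f ⊗ₜ g) = f a * g b := rfl

lemma pair_mul {a b : K} {ι κ : Type*} (ra : Coalgebra.Repr k a ι) (rb : Coalgebra.Repr k b κ)
    (z w : HopfDual k K ⊗[k] HopfDual k K) :
    pair a b (z * w) = ∑ i ∈ ra.index, ∑ j ∈ rb.index,
      pair (ra.left i) (rb.left j) z * pair (ra.right i) (rb.right j) w := by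
  induction z with
  | zero => simp
  | add x y hx hy => simp only [add_mul, map_add, hx, hy, Finset.sum_add_distrib]
  | tmul f₁ f₂ =>
    induction w with
    | zero => simp
    | add x y hx hy => simp only [mul_add, map_add, hx, hy, Finset.sum_add_distrib]
    | tmul g₁ g₂ =>
      rw [Algebra.TensorProduct.tmul_mul_tmul, pair_tmul, HopfDual.mul_apply ra, HopfDual.mul_apply rb,
        Finset.sum_mul_sum]
      refine Finset.sum_congr rfl fun i _ => Finset.sum_congr rfl fun j _ => ?_
      simp only [pair_tmul]
      ring

variable [FiniteDimensional k K]

variable (k K) in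
/-- The canonical isomorphism `K^* ⊗ K^* ≃ (K ⊗ K)^*`, `f ⊗ g ↦ (a ⊗ b ↦ f(a) g(b))`. -/
def tensorEquiv : HopfDual k K ⊗[k] HopfDual k K ≃ₗ[k] (K ⊗[k] K →ₗ[k] k) :=
  (TensorProduct.congr (toDual k K)
    (toDual k K)).trans (TensorProduct.dualDistribEquiv k K K)

lemma tensorEquiv_apply (z : HopfDual k K ⊗[k] HopfDual k K) (a b : K) :
    tensorEquiv k K z (a ⊗ₜ b) = pair a b z := by
  induction z with
  | zero => simp
  | add x y hx hy => simp [hx, hy]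
  | tmul f g => rfl

/-- The comultiplication is dual to the multiplication, `Δ(f)(a ⊗ b) = f(ab)`; the counit is
evaluation at `1`. -/
instance : CoalgebraStruct k (HopfDual k K) where
  comul := (tensorEquiv k K).symm.toLinearMap ∘ₗ
    (LinearMap.mul' k K).dualMap ∘ₗ (toDual k K).toLinearMap
  counit := ev 1

@[simp] lemma pair_comul (a b : K) (f : HopfDual k K) :
    pair a b (comul (R := k) f) = f (a * b) := by
  rw [← tensorEquiv_apply]
  change tensorEquiv k K ((tensorEquiv k K).symm _) (a ⊗ₜ b) = _
  rw [LinearEquiv.apply_symm_apply]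
  simp

@[simp] lemma counit_apply (f : HopfDual k K) : counit (R := k) f = f 1 := rfl

lemma ext_pair {z w : HopfDual k K ⊗[k] HopfDual k K} (h : ∀ a b, pair a b z = pair a b w) :
    z = w := by
  apply (tensorEquiv k K).injective
  ext a b
  simpa [tensorEquiv_apply] using h a b

lemma ext_pair₃ {z w : HopfDual k K ⊗[k] (HopfDual k K ⊗[k] HopfDual k K)}
    (h : ∀ a b c, LinearMap.mul' k k (TensorProduct.map (ev a) (pair b c) z) =
      LinearMap.mul' k k (TensorProduct.map (ev a) (pair b c) w)) : z = w := by
  let e := (TensorProduct.congr (toDual k K) (tensorEquiv k K)).trans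
    (TensorProduct.dualDistribEquiv k K (K ⊗[k] K))
  have he : ∀ z a b c, e z (a ⊗ₜ (b ⊗ₜ c)) =
      LinearMap.mul' k k (TensorProduct.map (ev a) (pair b c) z) := by
    intro z a b c
    induction z with
    | zero => simp
    | add x y hx hy => simp [hx, hy]
    | tmul f g =>
      change f a * tensorEquiv k K g (b ⊗ₜ c) = _
      rw [tensorEquiv_apply]
      rfl
  apply e.injective
  ext a b c
  simpa [he] using h a b c

instance : Coalgebra k (HopfDual k K) where
  coassoc := by
    ext1 f
    apply ext_pair₃
    intro a b c
    have h1 : ∀ z : HopfDual k K ⊗[k] HopfDual k K,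
        LinearMap.mul' k k (TensorProduct.map (ev a) (pair b c)
          (TensorProduct.assoc k _ _ _ (comul.rTensor _ z))) = pair (a * b) c z := by
      intro z
      induction z with
      | zero => simp
      | add x y hx hy => simp only [map_add, hx, hy]
      | tmul f g =>
        rw [LinearMap.rTensor_tmul, pair_tmul, ← pair_comul]
        generalize comul (R := k) f = y
        induction y with
        | zero => simp
        | add x y hx hy => simp only [TensorProduct.add_tmul, map_add, hx, hy, add_mul]
        | tmul f₁ f₂ => simp [mul_assoc]
    have h2 : ∀ z : HopfDual k K ⊗[k] HopfDual k K,
        LinearMap.mul' k k (TensorProduct.map (ev a) (pair b c) (comul.lTensor _ z)) =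
          pair a (b * c) z := by
      intro z
      induction z with
      | zero => simp
      | add x y hx hy => simp only [map_add, hx, hy]
      | tmul f g => simp
    simp only [LinearMap.comp_apply, LinearEquiv.coe_coe]
    rw [h1, h2, pair_comul, pair_comul, mul_assoc]
  rTensor_counit_comp_comul := by
    ext1 f
    apply (TensorProduct.lid k _).injective
    ext a
    have h : ∀ z : HopfDual k K ⊗[k] HopfDual k K,
        (TensorProduct.lid k _ (counit.rTensor _ z)) a = pair 1 a z := by
      intro z
      induction z with
      | zero => simp
      | add x y hx hy => simpa using congrArg₂ (· + ·) hx hy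
      | tmul f g => simp
    simpa using h (comul f)
  lTensor_counit_comp_comul := by
    ext1 f
    apply (TensorProduct.rid k _).injective
    ext a
    have h : ∀ z : HopfDual k K ⊗[k] HopfDual k K,
        (TensorProduct.rid k _ (counit.lTensor _ z)) a = pair a 1 z := by
      intro z
      induction z with
      | zero => simp
      | add x y hx hy => simpa using congrArg₂ (· + ·) hx hy
      | tmul f g => simp [mul_comm]
    simpa using h (comul f)

instance : Bialgebra k (HopfDual k K) :=
  Bialgebra.mk' k (HopfDual k K)
    (by simp [one_apply])
    (by
      intro f g
      rw [counit_apply, HopfDual.mul_apply (ι := Unit)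
        { index := {()}, left := fun _ => (1 : K), right := fun _ => 1,
          eq := by simp [Algebra.TensorProduct.one_def] }]
      simp)
    (by
      apply ext_pair
      intro a b
      simp [Algebra.TensorProduct.one_def, one_apply])
    (by
      intro f g
      apply ext_pair
      intro a b
      rw [pair_comul, pair_mul (ℛ k a) (ℛ k b), HopfDual.mul_apply (ι := (K × K) × (K × K))
        { index := (ℛ k a).index ×ˢ (ℛ k b).index
          left := fun i => (ℛ k a).left i.1 * (ℛ k b).left i.2
          right := fun i => (ℛ k a).right i.1 * (ℛ k b).right i.2
          eq := by
            rw [Bialgebra.comul_mul, ← (ℛ k a).eq, ← (ℛ k b).eq, Finset.sum_mul_sum,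
              Finset.sum_product]
            simp }]
      simp [Finset.sum_product])

/-- The antipode is the transpose of the antipode of `K`. -/
instance : HopfAlgebra k (HopfDual k K) where
  antipode := (toDual k K).symm.toLinearMap ∘ₗ
    (HopfAlgebra.antipode k (A := K)).dualMap ∘ₗ (toDual k K).toLinearMap
  mul_antipode_rTensor_comul := by
    ext f a
    have h : ∀ z : HopfDual k K ⊗[k] HopfDual k K,
        (LinearMap.mul' k _ (LinearMap.rTensor _
          ((toDual k K).symm.toLinearMap ∘ₗ
            (HopfAlgebra.antipode k (A := K)).dualMap ∘ₗ
            (toDual k K).toLinearMap) z)) a =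
        ∑ i ∈ (ℛ k a).index,
          pair (HopfAlgebra.antipode k ((ℛ k a).left i)) ((ℛ k a).right i) z := by
      intro z
      induction z with
      | zero => simp
      | add x y hx hy => simpa [Finset.sum_add_distrib] using congrArg₂ (· + ·) hx hy
      | tmul f g =>
        rw [LinearMap.rTensor_tmul, LinearMap.mul'_apply, HopfDual.mul_apply (ℛ k a)]
        rfl
    refine (h (comul f)).trans ?_
    simp only [pair_comul]
    rw [← map_sum, HopfAlgebra.sum_antipode_mul_eq_smul]
    simp [Algebra.algebraMap_eq_smul_one, one_apply, mul_comm]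
  mul_antipode_lTensor_comul := by
    ext f a
    have h : ∀ z : HopfDual k K ⊗[k] HopfDual k K,
        (LinearMap.mul' k _ (LinearMap.lTensor _
          ((toDual k K).symm.toLinearMap ∘ₗ
            (HopfAlgebra.antipode k (A := K)).dualMap ∘ₗ
            (toDual k K).toLinearMap) z)) a =
        ∑ i ∈ (ℛ k a).index,
          pair ((ℛ k a).left i) (HopfAlgebra.antipode k ((ℛ k a).right i)) z := by
      intro z
      induction z with
      | zero => simp
      | add x y hx hy => simpa [Finset.sum_add_distrib] using congrArg₂ (· + ·) hx hy
      | tmul f g =>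
        rw [LinearMap.lTensor_tmul, LinearMap.mul'_apply, HopfDual.mul_apply (ℛ k a)]
        rfl
    refine (h (comul f)).trans ?_
    simp only [pair_comul]
    rw [← map_sum, HopfAlgebra.sum_mul_antipode_eq_smul]
    simp [Algebra.algebraMap_eq_smul_one, one_apply, mul_comm]

end HopfDual
end HopfDual

/-- The elementary abelian `p`-group `C_p^n`, the `n`-fold product of the cyclic group of
order `p`. -/
abbrev ElemAbelian (p n : ℕ) : Type := Fin n → Multiplicative (ZMod p)

/-- The dual group algebra `k[C_p^n]^*`. -/
abbrev DualGroupAlgebra (k : Type u) [Field k] (p n : ℕ) : Type u :=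
  HopfDual k (MonoidAlgebra k (ElemAbelian p n))

/-! ## Cleft extensions and twist equivalence -/

section Cleft

variable {k : Type*} [Field k] {H : Type*} [Ring H] [HopfAlgebra k H]

/-- Primitive elements: `Δ(x) = x ⊗ 1 + 1 ⊗ x`. -/
def IsPrimitiveElement (k : Type*) [Field k] {H : Type*} [Ring H] [HopfAlgebra k H]
    (x : H) : Prop :=
  comul (R := k) x = x ⊗ₜ[k] (1 : H) + (1 : H) ⊗ₜ[k] x

variable {A B B' : Type*} [Ring A] [Algebra k A] [Ring B] [Algebra k B] [Ring B'] [Algebra k B']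

/-- `ρ : B → B ⊗ H` makes `B` a right `H`-comodule algebra. -/
structure IsComoduleAlgebra (ρ : B →ₐ[k] B ⊗[k] H) : Prop where
  coassoc : ∀ b, TensorProduct.assoc k B H H (ρ.toLinearMap.rTensor H (ρ b)) =
    (comul (R := k) (A := H)).lTensor B (ρ b)
  counit : ∀ b, (Coalgebra.counit (R := k) (A := H)).lTensor B (ρ b) = b ⊗ₜ[k] (1 : k)

/-- `A`, embedded into `B` by `ι`, is an `H`-cleft extension `A ⊆ B`, where `B` has the
`H`-coaction `ρ`: `B` is a right `H`-comodule algebra with `B^{co H} = A`, and there is a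
convolution invertible right `H`-comodule map `γ : H → B`. -/
structure IsCleftExtension (ι : A →ₐ[k] B) (ρ : B →ₐ[k] B ⊗[k] H) : Prop where
  isComoduleAlgebra : IsComoduleAlgebra ρ
  injective : Function.Injective ι
  coinvariants : ∀ b : B, ρ b = b ⊗ₜ[k] (1 : H) ↔ b ∈ Set.range ι
  exists_cleft_map : ∃ γ : H →ₗ[k] B,
    (∀ h, ρ (γ h) = γ.rTensor H (comul (R := k) h)) ∧ IsUnit (WithConv.toConv γ)

/-- Twist equivalence of the `H`-extensions `(B, ι, ρ)` and `(B', ι', ρ')` of `A`: there are an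
algebra automorphism `φ` of `A`, a Hopf algebra automorphism `ψ` of `H` and an algebra isomorphism
`f : B → B'` which is `A`-linear into `B'` with `A`-action twisted by `φ`, and `H`-colinear into
`B'` with coaction `(id ⊗ ψ) ∘ ρ'`. -/
def TwistEquivalent (ι : A →ₐ[k] B) (ρ : B →ₐ[k] B ⊗[k] H)
    (ι' : A →ₐ[k] B') (ρ' : B' →ₐ[k] B' ⊗[k] H) : Prop :=
  ∃ (φ : A ≃ₐ[k] A) (ψ : H ≃ₐc[k] H) (f : B ≃ₐ[k] B'),
    (∀ (a : A) (b : B), f (ι a * b) = ι' (φ a) * f b) ∧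
    (∀ b : B, (ψ : H →ₗ[k] H).lTensor B' (ρ' (f b)) = f.toLinearMap.rTensor H (ρ b))

end Cleft

/-! ## Module algebras and smash products -/

/-- An `H`-module algebra structure on `A`: an `H`-module structure `h · a = act h a` with
`h · 1 = ε(h) 1` and `h · (a b) = ∑ (h₁ · a) (h₂ · b)`. -/
@[ext] structure ModuleAlgebra (k : Type*) [Field k] (H : Type*) [Ring H] [HopfAlgebra k H]
    (A : Type*) [Ring A] [Algebra k A] where
  act : H →ₐ[k] Module.End k A
  act_one : ∀ h, act h 1 = algebraMap k A (counit (R := k) h)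
  act_mul : ∀ h a b, act h (a * b) =
    LinearMap.mul' k A (TensorProduct.map (act.toLinearMap.flip a) (act.toLinearMap.flip b)
      (comul (R := k) h))

/-- The underlying space `A ⊗ H` of the smash product `A # H`. -/
def SmashProduct {k : Type*} [Field k] {H : Type*} [Ring H] [HopfAlgebra k H]
    {A : Type*} [Ring A] [Algebra k A] (_S : ModuleAlgebra k H A) : Type _ := A ⊗[k] H

namespace SmashProduct

variable {k : Type*} [Field k] {H : Type*} [Ring H] [HopfAlgebra k H]
  {A : Type*} [Ring A] [Algebra k A] (S : ModuleAlgebra k H A)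

instance : AddCommGroup (SmashProduct S) := inferInstanceAs (AddCommGroup (A ⊗[k] H))

instance : Module k (SmashProduct S) := inferInstanceAs (Module k (A ⊗[k] H))

/-- The identification with `A ⊗ H`. -/
def toTensor : SmashProduct S ≃ₗ[k] A ⊗[k] H := LinearEquiv.refl k (A ⊗[k] H)

/-- The element `a # h`. -/
def mk (a : A) (h : H) : SmashProduct S := (toTensor S).symm (a ⊗ₜ h)

/-- The action of `A` on `A ⊗ H` by left multiplication on `A`. -/
def leftMul : A →ₗ[k] Module.End k (A ⊗[k] H) :=
  LinearMap.rTensorHom H ∘ₗ LinearMap.mul k A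

/-- The diagonal action of `H` on `A ⊗ H`, `h · (b ⊗ l) = ∑ (h₁ · b) ⊗ h₂ l`. -/
def diag : H →ₐ[k] Module.End k (A ⊗[k] H) :=
  (Module.endTensorEndAlgHom (R := k) (S := k) (A := k) (M := A) (N := H)).comp
    ((Algebra.TensorProduct.map S.act (Algebra.lmul k H)).comp (Bialgebra.comulAlgHom k H))

/-- The multiplication `(a # h)(b # l) = ∑ a (h₁ · b) # h₂ l` on `A ⊗ H`. -/
def mulMap : A ⊗[k] H →ₗ[k] Module.End k (A ⊗[k] H) :=
  LinearMap.mul' k (Module.End k (A ⊗[k] H)) ∘ₗ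
    TensorProduct.map leftMul (diag S).toLinearMap

lemma diag_tmul {ι : Type*} {h : H} (r : Coalgebra.Repr k h ι) (b : A) (l : H) :
    diag S h (b ⊗ₜ l) = ∑ i ∈ r.index, S.act (r.left i) b ⊗ₜ[k] (r.right i * l) := by
  simp only [diag, AlgHom.comp_apply, Bialgebra.comulAlgHom_apply, ← r.eq, map_sum,
    LinearMap.sum_apply, Algebra.TensorProduct.map_tmul]
  rfl

lemma mulMap_tmul (a : A) (h : H) (y : A ⊗[k] H) :
    mulMap S (a ⊗ₜ h) y = leftMul a (diag S h y) := rfl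

@[simp] lemma leftMul_tmul (a b : A) (l : H) :
    leftMul (k := k) a (b ⊗ₜ[k] l) = (a * b) ⊗ₜ[k] l := rfl

lemma leftMul_mul (a b : A) (y : A ⊗[k] H) :
    leftMul (k := k) (a * b) y = leftMul (k := k) a (leftMul (k := k) b y) := by
  induction y with
  | zero => simp
  | add x y hx hy => simp only [map_add, hx, hy]
  | tmul c l => simp [mul_assoc]

lemma act_mul_repr {ι : Type*} {h : H} (r : Coalgebra.Repr k h ι) (a b : A) :
    S.act h (a * b) = ∑ i ∈ r.index, S.act (r.left i) a * S.act (r.right i) b := by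
  simp [S.act_mul, ← r.eq]

lemma diag_leftMul {ι : Type*} {h : H} (r : Coalgebra.Repr k h ι) (b : A) (y : A ⊗[k] H) :
    diag S h (leftMul (k := k) b y) =
      ∑ i ∈ r.index, leftMul (k := k) (S.act (r.left i) b) (diag S (r.right i) y) := by
  induction y with
  | zero => simp
  | add x y hx hy => simp only [map_add, hx, hy, Finset.sum_add_distrib]
  | tmul c l =>
    let T : H ⊗[k] (H ⊗[k] H) →ₗ[k] A ⊗[k] H :=
      TensorProduct.map (LinearMap.mul' k A) LinearMap.id ∘ₗ
        (TensorProduct.assoc k A A H).symm.toLinearMap ∘ₗ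
        TensorProduct.map (S.act.toLinearMap.flip b)
          (TensorProduct.map (S.act.toLinearMap.flip c) (LinearMap.mulRight k l))
    have key := congrArg T (Coalgebra.sum_tmul_tmul_eq r (fun i => ℛ k (r.left i))
      (fun i => ℛ k (r.right i)))
    simp only [map_sum, T, LinearMap.comp_apply, TensorProduct.map_tmul,
      LinearEquiv.coe_coe, TensorProduct.assoc_symm_tmul, LinearMap.mul'_apply,
      LinearMap.flip_apply, AlgHom.toLinearMap_apply, LinearMap.mulRight_apply,
      LinearMap.id_apply] at key
    rw [leftMul_tmul, diag_tmul S r]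
    simp only [act_mul_repr S (ℛ k (r.left _)), TensorProduct.sum_tmul,
      diag_tmul S (ℛ k (r.right _)), map_sum, leftMul_tmul]
    exact key

lemma mulMap_mulMap (x y z : A ⊗[k] H) :
    mulMap S (mulMap S x y) z = mulMap S x (mulMap S y z) := by
  induction x with
  | zero => simp
  | add x x' hx hx' => simp only [map_add, LinearMap.add_apply, hx, hx']
  | tmul a h =>
    induction y with
    | zero => simp
    | add y y' hy hy' => simp only [map_add, LinearMap.add_apply, hy, hy']
    | tmul b l =>
      rw [mulMap_tmul, mulMap_tmul, mulMap_tmul, diag_leftMul S (ℛ k h), diag_tmul S (ℛ k h)]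
      simp only [map_sum, leftMul_tmul, LinearMap.sum_apply, mulMap_tmul, leftMul_mul, map_mul,
        Module.End.mul_apply]

lemma mulMap_one (x : A ⊗[k] H) : mulMap S x (1 ⊗ₜ 1) = x := by
  induction x with
  | zero => simp
  | add x y hx hy => simp only [map_add, LinearMap.add_apply, hx, hy]
  | tmul a h =>
    rw [mulMap_tmul, diag_tmul S (ℛ k h)]
    simp only [S.act_one, mul_one, Algebra.algebraMap_eq_smul_one, TensorProduct.smul_tmul,
      ← TensorProduct.tmul_sum, Coalgebra.sum_counit_smul, leftMul_tmul]

lemma one_mulMap (x : A ⊗[k] H) : mulMap S (1 ⊗ₜ 1) x = x := by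
  rw [mulMap_tmul, map_one (diag S)]
  induction x with
  | zero => simp
  | add x y hx hy => rw [map_add, map_add, hx, hy]
  | tmul a h => simp

instance : Ring (SmashProduct S) where
  mul x y := (toTensor S).symm (mulMap S (toTensor S x) (toTensor S y))
  one := mk S 1 1
  left_distrib x y z := by
    change (toTensor S).symm (mulMap S (toTensor S x) (toTensor S (y + z))) =
      (toTensor S).symm (mulMap S (toTensor S x) (toTensor S y)) +
        (toTensor S).symm (mulMap S (toTensor S x) (toTensor S z))
    simp only [map_add]
  right_distrib x y z := by
    change (toTensor S).symm (mulMap S (toTensor S (x + y)) (toTensor S z)) =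
      (toTensor S).symm (mulMap S (toTensor S x) (toTensor S z)) +
        (toTensor S).symm (mulMap S (toTensor S y) (toTensor S z))
    simp only [map_add, LinearMap.add_apply]
  zero_mul x := by
    change (toTensor S).symm (mulMap S (toTensor S 0) (toTensor S x)) = 0
    simp
  mul_zero x := by
    change (toTensor S).symm (mulMap S (toTensor S x) (toTensor S 0)) = 0
    simp
  mul_assoc x y z := mulMap_mulMap S x y z
  one_mul x := one_mulMap S x
  mul_one x := mulMap_one S x
  zsmul := zsmulRec
  neg_add_cancel := neg_add_cancel

lemma mul_def (x y : SmashProduct S) :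
    x * y = (toTensor S).symm (mulMap S (toTensor S x) (toTensor S y)) := rfl

lemma one_def : (1 : SmashProduct S) = mk S 1 1 := rfl

instance : Algebra k (SmashProduct S) :=
  Algebra.ofModule
    (fun c x y => by
      rw [mul_def, mul_def, map_smul, map_smul, LinearMap.smul_apply, map_smul])
    (fun c x y => by
      rw [mul_def, mul_def, map_smul, map_smul, map_smul])

/-- `(a # h)(b # l) = ∑ a (h₁ · b) # h₂ l`. -/
lemma mk_mul_mk {ι : Type*} {h : H} (r : Coalgebra.Repr k h ι) (a b : A) (l : H) :
    mk S a h * mk S b l =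
      ∑ i ∈ r.index, mk S (a * S.act (r.left i) b) (r.right i * l) := by
  rw [mul_def]
  simp only [mk, LinearEquiv.apply_symm_apply]
  rw [mulMap_tmul, diag_tmul S r, map_sum, map_sum]
  simp only [leftMul_tmul]

@[elab_as_elim] lemma induction_on {P : SmashProduct S → Prop} (x : SmashProduct S)
    (zero : P 0) (mk : ∀ a h, P (mk S a h)) (add : ∀ x y, P x → P y → P (x + y)) : P x :=
  TensorProduct.induction_on (motive := P) x zero mk add

/-- The embedding `a ↦ a # 1` of `A` into `A # H`. -/
def incl : A →ₐ[k] SmashProduct S :=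
  AlgHom.ofLinearMap
    ((toTensor S).symm.toLinearMap ∘ₗ (TensorProduct.mk k A H).flip 1)
    rfl
    (fun a b => by
      change mk S (a * b) 1 = mk S a 1 * mk S b 1
      rw [mk_mul_mk S (ι := Unit)
        { index := {()}, left := fun _ => (1 : H), right := fun _ => 1,
          eq := by simp [Algebra.TensorProduct.one_def] }]
      simp)

lemma incl_apply (a : A) : incl S a = mk S a 1 := rfl

/-- The coaction `a # h ↦ ∑ (a # h₁) ⊗ h₂` as a linear map. -/
def coactionLin : SmashProduct S →ₗ[k] SmashProduct S ⊗[k] H :=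
  (toTensor S).symm.toLinearMap.rTensor H ∘ₗ
    (TensorProduct.assoc k A H H).symm.toLinearMap ∘ₗ
    (comul (R := k) (A := H)).lTensor A ∘ₗ (toTensor S).toLinearMap

lemma coactionLin_mk {ι : Type*} {h : H} (r : Coalgebra.Repr k h ι) (a : A) :
    coactionLin S (mk S a h) = ∑ i ∈ r.index, mk S a (r.left i) ⊗ₜ[k] r.right i := by
  simp only [coactionLin, mk, LinearMap.comp_apply, LinearEquiv.coe_coe,
    LinearEquiv.apply_symm_apply, LinearMap.lTensor_tmul, ← r.eq, TensorProduct.tmul_sum,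
    map_sum, TensorProduct.assoc_symm_tmul, LinearMap.rTensor_tmul]

lemma coactionLin_mul (x y : SmashProduct S) :
    coactionLin S (x * y) = coactionLin S x * coactionLin S y := by
  induction x using induction_on with
  | zero => simp
  | add x x' hx hx' => simp only [add_mul, map_add, hx, hx']
  | mk a h =>
    induction y using induction_on with
    | zero => simp
    | add y y' hy hy' => simp only [mul_add, map_add, hy, hy']
    | mk b l =>
      let rh := ℛ k h
      let rl := ℛ k l
      let T : H ⊗[k] (H ⊗[k] H) →ₗ[k] SmashProduct S ⊗[k] H :=
        ∑ j ∈ rl.index, (toTensor S).symm.toLinearMap.rTensor H ∘ₗ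
          (TensorProduct.assoc k A H H).symm.toLinearMap ∘ₗ
          TensorProduct.map (LinearMap.mulLeft k a ∘ₗ S.act.toLinearMap.flip b)
            (TensorProduct.map (LinearMap.mulRight k (rl.left j))
              (LinearMap.mulRight k (rl.right j)))
      have hT : ∀ u v w : H, T (u ⊗ₜ (v ⊗ₜ w)) = ∑ j ∈ rl.index,
          mk S (a * S.act u b) (v * rl.left j) ⊗ₜ[k] (w * rl.right j) := by
        intro u v w
        simp only [T, LinearMap.sum_apply]
        rfl
      have key := congrArg T (Coalgebra.sum_tmul_tmul_eq rh (fun i => ℛ k (rh.left i))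
        (fun i => ℛ k (rh.right i)))
      simp only [map_sum, hT] at key
      rw [mk_mul_mk S rh, map_sum, coactionLin_mk S rh, coactionLin_mk S rl,
        Finset.sum_mul_sum]
      have h1 : ∀ i, coactionLin S (mk S (a * S.act (rh.left i) b) (rh.right i * l)) =
          ∑ m ∈ (ℛ k (rh.right i)).index, ∑ j ∈ rl.index,
            mk S (a * S.act (rh.left i) b) ((ℛ k (rh.right i)).left m * rl.left j) ⊗ₜ[k]
              ((ℛ k (rh.right i)).right m * rl.right j) := by
        intro i
        rw [coactionLin_mk S (ι := (H × H) × (H × H))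
          { index := (ℛ k (rh.right i)).index ×ˢ rl.index
            left := fun q => (ℛ k (rh.right i)).left q.1 * rl.left q.2
            right := fun q => (ℛ k (rh.right i)).right q.1 * rl.right q.2
            eq := by
              rw [Bialgebra.comul_mul, ← (ℛ k (rh.right i)).eq, ← rl.eq, Finset.sum_mul_sum,
                Finset.sum_product]
              simp }]
        rw [Finset.sum_product]
      simp only [h1, ← key]
      refine Finset.sum_congr rfl fun i _ => ?_
      rw [Finset.sum_comm]
      refine Finset.sum_congr rfl fun j _ => ?_
      rw [Algebra.TensorProduct.tmul_mul_tmul, mk_mul_mk S (ℛ k (rh.left i)),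
        TensorProduct.sum_tmul]

/-- The coaction `a # h ↦ ∑ (a # h₁) ⊗ h₂` of `H` on `A # H`. -/
def coaction : SmashProduct S →ₐ[k] SmashProduct S ⊗[k] H :=
  AlgHom.ofLinearMap (coactionLin S)
    (by
      rw [one_def, coactionLin_mk S (ι := Unit)
        { index := {()}, left := fun _ => (1 : H), right := fun _ => 1,
          eq := by simp [Algebra.TensorProduct.one_def] }]
      simp [Algebra.TensorProduct.one_def, one_def])
    (coactionLin_mul S)

lemma coaction_mk {ι : Type*} {h : H} (r : Coalgebra.Repr k h ι) (a : A) :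
    coaction S (mk S a h) = ∑ i ∈ r.index, mk S a (r.left i) ⊗ₜ[k] r.right i :=
  coactionLin_mk S r a

lemma isComoduleAlgebra : IsComoduleAlgebra (coaction S) where
  coassoc x := by
    induction x using induction_on with
    | zero => simp
    | add x y hx hy => simp only [map_add, hx, hy]
    | mk a h =>
      let r := ℛ k h
      have key := congrArg (((toTensor S).symm.toLinearMap ∘ₗ TensorProduct.mk k A H a).rTensor
          (H ⊗[k] H)) (Coalgebra.sum_tmul_tmul_eq r (fun i => ℛ k (r.left i))
        (fun i => ℛ k (r.right i)))
      have hm : ∀ u, ((toTensor S).symm.toLinearMap ∘ₗ TensorProduct.mk k A H a) u = mk S a u :=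
        fun _ => rfl
      simp only [map_sum, LinearMap.rTensor_tmul, hm] at key
      rw [coaction_mk S r]
      simp only [map_sum, LinearMap.rTensor_tmul, LinearMap.lTensor_tmul,
        AlgHom.toLinearMap_apply, coaction_mk S (ℛ k (r.left _)), TensorProduct.sum_tmul,
        TensorProduct.assoc_tmul]
      rw [key]
      refine Finset.sum_congr rfl fun i _ => ?_
      rw [← TensorProduct.tmul_sum, (ℛ k (r.right i)).eq]
  counit x := by
    induction x using induction_on with
    | zero => simp
    | add x y hx hy => simp only [map_add, hx, hy, TensorProduct.add_tmul]
    | mk a h =>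
      let r := ℛ k h
      have key := congrArg (((toTensor S).symm.toLinearMap ∘ₗ TensorProduct.mk k A H a).rTensor k)
        (Coalgebra.sum_tmul_counit_eq (R := k) r)
      have hm : ∀ u, ((toTensor S).symm.toLinearMap ∘ₗ TensorProduct.mk k A H a) u = mk S a u :=
        fun _ => rfl
      simp only [map_sum, LinearMap.rTensor_tmul, hm] at key
      rw [coaction_mk S r]
      simpa only [map_sum, LinearMap.lTensor_tmul] using key

/-- `(a # h) ↦ ε(h) a`. -/
def proj : SmashProduct S →ₗ[k] A :=
  (TensorProduct.rid k A).toLinearMap ∘ₗ (counit (R := k) (A := H)).lTensor A ∘ₗ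
    (toTensor S).toLinearMap

lemma proj_mk (a : A) (h : H) : proj S (mk S a h) = counit (R := k) h • a := rfl

lemma proj_coaction (x : SmashProduct S) :
    (proj S).rTensor H (coaction S x) = toTensor S x := by
  induction x using induction_on with
  | zero => simp
  | add x y hx hy => simp only [map_add, hx, hy]
  | mk a h =>
    rw [coaction_mk S (ℛ k h), map_sum]
    simp only [LinearMap.rTensor_tmul, proj_mk, TensorProduct.smul_tmul]
    rw [← TensorProduct.tmul_sum, Coalgebra.sum_counit_smul]
    rfl

/-- `A # H` is an `H`-cleft extension of `A`. -/
theorem isCleftExtension : IsCleftExtension (incl S) (coaction S) where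
  isComoduleAlgebra := isComoduleAlgebra S
  injective a b h := by
    have := congrArg (proj S) h
    simpa [incl_apply, proj_mk] using this
  coinvariants x := by
    constructor
    · intro h
      refine ⟨proj S x, (toTensor S).injective ?_⟩
      rw [← proj_coaction S x, h]
      rfl
    · rintro ⟨a, rfl⟩
      rw [incl_apply, coaction_mk S (ι := Unit)
        { index := {()}, left := fun _ => (1 : H), right := fun _ => 1,
          eq := by simp [Algebra.TensorProduct.one_def] }]
      simp
  exists_cleft_map := by
    let γ : H →ₗ[k] SmashProduct S := (toTensor S).symm.toLinearMap ∘ₗ TensorProduct.mk k A H 1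
    have hγ : ∀ h, γ h = mk S 1 h := fun _ => rfl
    have hmul : ∀ g h, γ g * γ h = γ (g * h) := by
      intro g h
      rw [hγ, hγ, mk_mul_mk S (ℛ k g)]
      simp only [S.act_one, one_mul]
      rw [hγ]
      conv_rhs => rw [← Coalgebra.sum_counit_smul (ℛ k g)]
      rw [Finset.sum_mul]
      simp only [mk, ← map_sum, Algebra.algebraMap_eq_smul_one, TensorProduct.smul_tmul,
        ← TensorProduct.tmul_sum, smul_mul_assoc]
    refine ⟨γ, fun h => ?_, ?_⟩
    · rw [hγ, coaction_mk S (ℛ k h), ← (ℛ k h).eq, map_sum]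
      rfl
    · refine isUnit_iff_exists.mpr
        ⟨WithConv.toConv (γ ∘ₗ HopfAlgebra.antipode k (A := H)), ?_, ?_⟩
      · ext h
        change (WithConv.toConv γ * WithConv.toConv (γ ∘ₗ HopfAlgebra.antipode k)) h = _
        rw [(ℛ k h).convMul_apply]
        change ∑ i ∈ (ℛ k h).index, γ ((ℛ k h).left i) *
          γ (HopfAlgebra.antipode k ((ℛ k h).right i)) = _
        simp only [hmul, ← map_sum]
        rw [HopfAlgebra.sum_mul_antipode_eq_smul, map_smul, hγ, ← one_def,
          ← Algebra.algebraMap_eq_smul_one]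
        rfl
      · ext h
        change (WithConv.toConv (γ ∘ₗ HopfAlgebra.antipode k) * WithConv.toConv γ) h = _
        rw [(ℛ k h).convMul_apply]
        change ∑ i ∈ (ℛ k h).index, γ (HopfAlgebra.antipode k ((ℛ k h).left i)) *
          γ ((ℛ k h).right i) = _
        simp only [hmul, ← map_sum]
        rw [HopfAlgebra.sum_antipode_mul_eq_smul, map_smul, hγ, ← one_def,
          ← Algebra.algebraMap_eq_smul_one]
        rfl

end SmashProduct

end

noncomputable section

/-! ## Algebras with one generator -/

section Monogenic

open Polynomial

variable {k R : Type*} [Field k] [Ring R] [Algebra k R]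

/-! Write `q = p ^ n`. The additive group of the field with `q` elements is `C_p^n`, and it embeds
in `k`; as a function on the group this embedding is a primitive `x ∈ H` with `x ^ q = x`, and it
generates `H` by interpolation. Comparing dimensions, `H = k[X]/(X ^ q - X)`
(`IsPrimitiveGenerator.exists_algHom`). Hence an `H`-module algebra structure on `A` is the same as
a derivation `D` of `A` with `D ^ q = D`, the action of `x`
(`IsPrimitiveGenerator.exists_moduleAlgebra`).

In a cleft extension `B`, the cleaving map yields `y` with `ρ(y) = y ⊗ 1 + 1 ⊗ x`. Then `y ^ q - y`
lies in `A`, and since Artin–Schreier equations are solvable in `A`, adding an element of `A` to `y`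
achieves `y ^ q = y`. Now `x ↦ y` is a comodule algebra map `H → B`; averaging over the group shows
that it splits `B` as `A ⊗ H` (`bijective_liftLin`). The commutator with `y` is a derivation `D` of
`A` with `D ^ q = D`, so `B` is the smash product for `D`. Up to twist equivalence `D` may be
conjugated by an automorphism of `A`, and scaled by `c ≠ 0` with `c ^ q = c`, because `x ↦ c x` is a
Hopf automorphism.

Let `t` be a nilpotent generator of `A`. As `X ^ q - X` is separable, `D` is diagonalizable
(`derivation_normal_form`). A unit eigenvector with eigenvalue `μ ≠ 0` is a scalar multiple of `s +
1`, where `s` is again a nilpotent generator and `D s = μ (s + 1)`. If there is none, `D` maps `A`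
into `tA`, and for `t ≠ 0` an eigenvector outside `k + t²A` is, up to a constant, a generator `s`
with `D s = 0` or `D s = μ s`. For `m = dim A`, applying `D` to `t ^ m = 0` shows that `D t = t + 1`
forces `p ∣ m`.

Conversely, a twist equivalence of smash products conjugates the action of `x` on one side into the
action of another primitive element on the other (`TwistEquivalent.exists_conj`). Vanishing of the
action of `x` and stability of the maximal ideal under `H` are therefore invariants, and they
separate the three actions. -/

lemma Algebra.aeval_surjective_of_adjoin_eq_top {r : R} (hr : Algebra.adjoin k {r} = ⊤) :
    Function.Surjective (aeval r : k[X] →ₐ[k] R) := by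
  rw [← AlgHom.range_eq_top, ← Algebra.adjoin_singleton_eq_range_aeval, hr]

lemma Algebra.aeval_eq_zero_of_mem_span {c : R} {P : k[X]}
    (hc : aeval c P = 0) (a : k[X]) (ha : a ∈ Ideal.span {P}) : aeval c a = 0 := by
  obtain ⟨b, rfl⟩ := Ideal.mem_span_singleton.mp ha
  rw [map_mul, hc, zero_mul]

/-- If `r` generates `R` and `P` is a monic polynomial of degree `dim R` with `P(r) = 0`, then
`R` has the universal property of `k[X]/(P)`. -/
lemma Algebra.exists_algHom_of_adjoin_eq_top [FiniteDimensional k R] {r : R}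
    (hr : Algebra.adjoin k {r} = ⊤) {P : k[X]} (hP : P.Monic)
    (hdeg : P.natDegree = Module.finrank k R) (h0 : aeval r P = 0)
    {C : Type*} [Ring C] [Algebra k C] (c : C) (hc : aeval c P = 0) :
    ∃ F : R →ₐ[k] C, F r = c := by
  let e : k[X] ⧸ Ideal.span {P} →ₐ[k] R := Ideal.Quotient.liftₐ _ (aeval r)
    (Algebra.aeval_eq_zero_of_mem_span h0)
  have heX : ∀ a : k[X], e (Ideal.Quotient.mk _ a) = aeval r a := fun a => rfl
  have hsurj : Function.Surjective e := fun y => by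
    obtain ⟨a, ha⟩ := Algebra.aeval_surjective_of_adjoin_eq_top hr y
    exact ⟨Ideal.Quotient.mk _ a, ha⟩
  have hfd : FiniteDimensional k (k[X] ⧸ Ideal.span {P}) :=
    (AdjoinRoot.powerBasis' hP).finite
  have hrank : Module.finrank k (k[X] ⧸ Ideal.span {P}) = Module.finrank k R := by
    rw [← hdeg]
    exact (AdjoinRoot.powerBasis' hP).finrank
  have hinj : Function.Injective e :=
    (LinearMap.injective_iff_surjective_of_finrank_eq_finrank (f := e.toLinearMap) hrank).mpr hsurj
  let e' := AlgEquiv.ofBijective e ⟨hinj, hsurj⟩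
  let F : k[X] ⧸ Ideal.span {P} →ₐ[k] C := Ideal.Quotient.liftₐ _ (aeval c)
    (Algebra.aeval_eq_zero_of_mem_span hc)
  refine ⟨F.comp e'.symm.toAlgHom, ?_⟩
  have : e'.symm r = Ideal.Quotient.mk _ X := by
    rw [AlgEquiv.symm_apply_eq]
    exact ((heX X).trans (aeval_X r)).symm
  change F (e'.symm r) = c
  rw [this]
  exact aeval_X c

/-- Two algebra maps on an algebra with one generator agree if they agree on the generator. -/
lemma Algebra.algHom_ext_of_adjoin_eq_top {r : R} (hr : Algebra.adjoin k {r} = ⊤)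
    {C : Type*} [Semiring C] [Algebra k C] {F F' : R →ₐ[k] C} (h : F r = F' r) : F = F' :=
  AlgHom.ext_of_adjoin_eq_top hr fun y hy => by
    rw [Set.mem_singleton_iff.mp hy, h]

/-- A subalgebra containing a generator contains everything. -/
lemma Algebra.mem_of_adjoin_eq_top {r : R} (hr : Algebra.adjoin k {r} = ⊤)
    (T : Subalgebra k R) (h : r ∈ T) (a : R) : a ∈ T := by
  have : Algebra.adjoin k {r} ≤ T := Algebra.adjoin_le (by simpa using h)
  exact this (hr ▸ Algebra.mem_top)

end Monogenic

/-! ## The dual of a group algebra -/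

namespace HopfDual

section Group

variable {k : Type u} [Field k] {G : Type v} [Group G]

lemma mul_apply_of (f f' : HopfDual k (MonoidAlgebra k G)) (g : G) :
    (f * f') (MonoidAlgebra.of k G g) = f (MonoidAlgebra.of k G g) * f' (MonoidAlgebra.of k G g) := by
  rw [mul_apply (ι := Unit)
    { index := {()}, left := fun _ => MonoidAlgebra.of k G g,
      right := fun _ => MonoidAlgebra.of k G g,
      eq := by simp }]
  simp

lemma one_apply_of (g : G) :
    (1 : HopfDual k (MonoidAlgebra k G)) (MonoidAlgebra.of k G g) = 1 := by
  rw [one_apply]; simp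

/-- Evaluation of functions on `G` at `g`. -/
def evalAt (g : G) : HopfDual k (MonoidAlgebra k G) →ₐ[k] k :=
  AlgHom.ofLinearMap (ev (MonoidAlgebra.of k G g)) (one_apply_of g)
    (fun f f' => mul_apply_of f f' g)

lemma ext_evalAt {f f' : HopfDual k (MonoidAlgebra k G)}
    (h : ∀ g, evalAt (k := k) g f = evalAt g f') : f = f' := by
  apply (toDual k _).injective
  exact MonoidAlgebra.lhom_ext' fun g => LinearMap.ext_ring (h g)

/-- The element of `k[G]^*` given by a function on `G`. -/
def ofFun (c : G → k) : HopfDual k (MonoidAlgebra k G) :=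
  (toDual k _).symm (Finsupp.lift k k G c ∘ₗ (MonoidAlgebra.coeffLinearEquiv k).toLinearMap)

@[simp] lemma evalAt_ofFun (g : G) (c : G → k) : evalAt g (ofFun c) = c g := by
  change (Finsupp.lift k k G c) (Finsupp.single g (1 : k)) = _
  simp

open Classical in
/-- The characteristic function of `{g}`. -/
def delta (g : G) : HopfDual k (MonoidAlgebra k G) := ofFun (Pi.single g 1)

open Classical in
lemma evalAt_delta (g h : G) : evalAt (k := k) h (delta g) = if h = g then 1 else 0 := by
  rw [delta, evalAt_ofFun, Pi.single_apply]

lemma delta_mul_delta_self (g : G) : delta (k := k) g * delta g = delta g := by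
  classical
  apply ext_evalAt
  intro a
  by_cases h : a = g <;> simp [evalAt_delta, h]

lemma delta_mul_delta_of_ne {g h : G} (hgh : g ≠ h) : delta (k := k) g * delta h = 0 := by
  classical
  apply ext_evalAt
  intro a
  by_cases h : a = g
  · subst h
    simp [evalAt_delta, hgh]
  · simp [evalAt_delta, h]

instance [Finite G] : FiniteDimensional k (HopfDual k (MonoidAlgebra k G)) :=
  Module.Finite.equiv (toDual k (MonoidAlgebra k G)).symm

variable [Fintype G]

lemma finrank_monoidAlgebra : Module.finrank k (HopfDual k (MonoidAlgebra k G)) = Fintype.card G := by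
  rw [(toDual k (MonoidAlgebra k G)).finrank_eq]
  refine (Subspace.dual_finrank_eq (K := k) (V := MonoidAlgebra k G)).trans ?_
  rw [(MonoidAlgebra.coeffLinearEquiv k).finrank_eq]
  exact Module.finrank_finsupp_self k

lemma evalAt_comul (f : HopfDual k (MonoidAlgebra k G)) (g h : G) :
    LinearMap.mul' k k (TensorProduct.map (evalAt g).toLinearMap (evalAt h).toLinearMap
      (comul (R := k) f)) = evalAt (g * h) f := by
  have := pair_comul (MonoidAlgebra.of k G g) (MonoidAlgebra.of k G h) f
  rw [← map_mul] at this
  exact this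

lemma ext_evalAt_tensor {z w : HopfDual k (MonoidAlgebra k G) ⊗[k] HopfDual k (MonoidAlgebra k G)}
    (h : ∀ a b : G, LinearMap.mul' k k
      (TensorProduct.map (evalAt a).toLinearMap (evalAt b).toLinearMap z) =
      LinearMap.mul' k k
      (TensorProduct.map (evalAt a).toLinearMap (evalAt b).toLinearMap w)) : z = w := by
  apply (tensorEquiv k (MonoidAlgebra k G)).injective
  apply TensorProduct.ext
  refine MonoidAlgebra.lhom_ext' fun a => LinearMap.ext_ring (MonoidAlgebra.lhom_ext' fun b =>
    LinearMap.ext_ring ?_)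
  have := h a b
  exact (tensorEquiv_apply z _ _).trans (this.trans (tensorEquiv_apply w _ _).symm)

lemma sum_evalAt_smul_delta (f : HopfDual k (MonoidAlgebra k G)) :
    ∑ g : G, evalAt g f • delta g = f := by
  classical
  apply ext_evalAt
  intro h
  simp [evalAt_delta]

lemma sum_delta : ∑ g : G, delta (k := k) g = 1 := by
  conv_rhs => rw [← sum_evalAt_smul_delta (1 : HopfDual k (MonoidAlgebra k G))]
  simp

/-- Slicing a tensor at `g`. -/
def slice (k : Type u) [Field k] {G : Type v} [Group G] [Fintype G]
    (B : Type*) [Ring B] [Algebra k B] (g : G) :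
    B ⊗[k] HopfDual k (MonoidAlgebra k G) →ₐ[k] B :=
  (Algebra.TensorProduct.rid k k B).toAlgHom.comp
    (Algebra.TensorProduct.map (AlgHom.id k B) (evalAt g))

@[simp] lemma slice_tmul {B : Type*} [Ring B] [Algebra k B] (g : G) (b : B)
    (f : HopfDual k (MonoidAlgebra k G)) : slice k B g (b ⊗ₜ f) = evalAt g f • b := by
  simp [slice]

lemma sum_slice_tmul_delta {B : Type*} [Ring B] [Algebra k B]
    (z : B ⊗[k] HopfDual k (MonoidAlgebra k G)) :
    ∑ g : G, slice k B g z ⊗ₜ[k] delta g = z := by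
  induction z with
  | zero => simp
  | add x y hx hy => simp only [map_add, TensorProduct.add_tmul, Finset.sum_add_distrib, hx, hy]
  | tmul b f =>
    simp only [slice_tmul, TensorProduct.smul_tmul]
    rw [← TensorProduct.tmul_sum, sum_evalAt_smul_delta]

end Group

end HopfDual

/-! ## Primitive generators of the dual of an elementary abelian group algebra -/

section ElemAbelian

open HopfDual

variable (p : ℕ) [Fact p.Prime] (n : ℕ) (k : Type u) [Field k]

instance : Fintype (ElemAbelian p n) :=
  inferInstanceAs (Fintype (Fin n → ZMod p))

lemma card_elemAbelian : Fintype.card (ElemAbelian p n) = p ^ n := by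
  have : Fintype.card (Fin n → ZMod p) = p ^ n := by simp [ZMod.card]
  exact this

lemma DualGroupAlgebra.finrank_eq : Module.finrank k (DualGroupAlgebra k p n) = p ^ n := by
  rw [HopfDual.finrank_monoidAlgebra, card_elemAbelian]

/-- `C_p^n` is the additive group of the field with `p ^ n` elements, which embeds in the
algebraically closed field `k`. Additivity makes the resulting function primitive, injectivity makes
it a generator, and the last property gives `x ^ p ^ n = x`. -/
lemma exists_injective_additive_char [IsAlgClosed k] [CharP k p] (hn : n ≠ 0) :
    ∃ χ : ElemAbelian p n → k, Function.Injective χ ∧ (∀ g h, χ (g * h) = χ g + χ h) ∧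
      ∀ g, χ g ^ p ^ n = χ g := by
  let := ZMod.algebra k p
  let j : GaloisField p n →ₐ[ZMod p] k := IsAlgClosed.lift
  have hfr := GaloisField.finrank p hn
  let e : GaloisField p n ≃ₗ[ZMod p] (Fin n → ZMod p) :=
    LinearEquiv.ofFinrankEq _ _ (by rw [hfr]; simp)
  have hcard := GaloisField.card p n hn
  let : Fintype (GaloisField p n) := Fintype.ofFinite _
  refine ⟨fun g => j (e.symm fun i => (g i).toAdd), ?_, ?_, ?_⟩
  · intro g h hgh
    have := e.symm.injective (j.toRingHom.injective hgh)
    funext i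
    exact congrFun this i
  · intro g h
    rw [← map_add, ← map_add]
    rfl
  · intro g
    rw [← map_pow]
    congr 1
    rw [← hcard, Nat.card_eq_fintype_card]
    exact FiniteField.pow_card _

lemma isPrimitiveElement_ofFun {χ : ElemAbelian p n → k} (h : ∀ g h, χ (g * h) = χ g + χ h) :
    IsPrimitiveElement k (ofFun χ : DualGroupAlgebra k p n) := by
  apply ext_evalAt_tensor
  intro a b
  rw [evalAt_comul]
  simp [h]

/-- Lagrange interpolation at the distinct nodes `χ g` writes every function on the group as a
polynomial in `χ`. -/
lemma adjoin_ofFun_eq_top {χ : ElemAbelian p n → k} (h : Function.Injective χ) :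
    Algebra.adjoin k {(ofFun χ : DualGroupAlgebra k p n)} = ⊤ := by
  classical
  rw [eq_top_iff]
  intro f _
  have : f = Polynomial.aeval (ofFun χ : DualGroupAlgebra k p n)
      (Lagrange.interpolate Finset.univ χ fun g => evalAt g f) := by
    apply ext_evalAt
    intro g
    rw [← Polynomial.aeval_algHom_apply, evalAt_ofFun, Polynomial.coe_aeval_eq_eval,
      Lagrange.eval_interpolate_at_node _ h.injOn (Finset.mem_univ g)]
  rw [this]
  exact Polynomial.aeval_mem_adjoin_singleton k _

theorem exists_primitive_generator [IsAlgClosed k] [CharP k p] (hn : n ≠ 0) :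
    ∃ x : DualGroupAlgebra k p n, IsPrimitiveElement k x ∧
      Algebra.adjoin k {x} = ⊤ ∧ x ^ p ^ n = x := by
  obtain ⟨χ, hinj, hadd, hpow⟩ := exists_injective_additive_char p n k hn
  refine ⟨ofFun χ, isPrimitiveElement_ofFun p n k hadd, adjoin_ofFun_eq_top p n k hinj, ?_⟩
  apply ext_evalAt
  intro g
  rw [map_pow, evalAt_ofFun, hpow]

end ElemAbelian

/-! ### Module algebra structures over a Hopf algebra with a primitive generator -/

section ModuleAlgebraGenerator

open Polynomial

variable {k : Type*} [Field k] {H : Type*} [Ring H] [HopfAlgebra k H]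

/-- `x` is a primitive element generating `H` with `x ^ q = x`, where `q = dim H`. -/
structure IsPrimitiveGenerator (k : Type*) [Field k] {H : Type*} [Ring H] [HopfAlgebra k H]
    (q : ℕ) (x : H) : Prop where
  primitive : IsPrimitiveElement k x
  adjoin_eq_top : Algebra.adjoin k {x} = ⊤
  pow_eq : x ^ q = x
  finrank_eq : Module.finrank k H = q
  one_lt : 1 < q

namespace IsPrimitiveElement

variable {x : H} (hx : IsPrimitiveElement k x)
include hx

/-- The Sweedler representation of a primitive element. -/
lemma exists_repr : ∃ r : Coalgebra.Repr k x Bool, r.index = Finset.univ ∧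
    r.left true = x ∧ r.right true = 1 ∧ r.left false = 1 ∧ r.right false = x :=
  ⟨{ index := Finset.univ, left := fun i => if i then x else 1,
     right := fun i => if i then 1 else x,
     eq := by rw [hx]; simp }, rfl, rfl, rfl, rfl, rfl⟩

lemma counit_eq_zero : counit (R := k) x = 0 := by
  have h := Coalgebra.rTensor_counit_comul (R := k) x
  rw [hx, map_add, LinearMap.rTensor_tmul, LinearMap.rTensor_tmul, Bialgebra.counit_one] at h
  have h2 := congrArg (LinearMap.mul' k k ∘ₗ (counit (R := k) (A := H)).lTensor k) h
  simpa using h2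

lemma act_mul {A : Type*} [Ring A] [Algebra k A] (S : ModuleAlgebra k H A) (a b : A) :
    S.act x (a * b) = S.act x a * b + a * S.act x b := by
  rw [S.act_mul, hx]
  simp

end IsPrimitiveElement

namespace IsPrimitiveGenerator

variable {q : ℕ} {x : H} (hx : IsPrimitiveGenerator k q x)
include hx

/-- The generator `x` is a root of the monic polynomial `X ^ q - X`, whose degree is `dim H`, so `H
= k[X]/(X ^ q - X)`. -/
lemma exists_algHom {C : Type*} [Ring C] [Algebra k C] (c : C) (hc : c ^ q = c) :
    ∃ F : H →ₐ[k] C, F x = c := by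
  have hq := hx.one_lt
  have : FiniteDimensional k H := Module.finite_of_finrank_pos (by rw [hx.finrank_eq]; omega)
  have hdeg : (X : k[X]).degree < (q : ℕ) := by
    rw [degree_X]; exact_mod_cast hq
  have hmonic : (X ^ q - X : k[X]).Monic := monic_X_pow_sub hdeg
  refine Algebra.exists_algHom_of_adjoin_eq_top hx.adjoin_eq_top hmonic ?_ ?_ c ?_
  · rw [hx.finrank_eq]
    exact FiniteField.X_pow_card_sub_X_natDegree_eq k hq
  · simp [hx.pow_eq]
  · simp [hc]

lemma algHom_ext {C : Type*} [Semiring C] [Algebra k C] {F F' : H →ₐ[k] C} (h : F x = F' x) :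
    F = F' :=
  Algebra.algHom_ext_of_adjoin_eq_top hx.adjoin_eq_top h

/-- Scaling the generator by `c` with `c ^ q = c` is a Hopf algebra automorphism. -/
lemma exists_scaling {c : k} (hc : c ^ q = c) (hc0 : c ≠ 0) :
    ∃ ψ : H ≃ₐc[k] H, ψ x = c • x := by
  obtain ⟨F, hF⟩ := hx.exists_algHom (c • x) (by rw [_root_.smul_pow, hc, hx.pow_eq])
  obtain ⟨F', hF'⟩ := hx.exists_algHom (c⁻¹ • x) (by rw [_root_.smul_pow, inv_pow, hc, hx.pow_eq])
  let e : H ≃ₐ[k] H := AlgEquiv.ofAlgHom F F'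
    (hx.algHom_ext (by simp [hF, hF', smul_smul, hc0]))
    (hx.algHom_ext (by simp [hF, hF', smul_smul, hc0]))
  have heF : (e : H →ₐ[k] H) x = c • x := hF
  refine ⟨BialgEquiv.ofAlgEquiv e (hx.algHom_ext ?_) (hx.algHom_ext ?_), hF⟩
  · simp only [AlgHom.comp_apply, Bialgebra.counitAlgHom_apply]
    rw [heF, map_smul, hx.primitive.counit_eq_zero, smul_zero]
  · simp only [AlgHom.comp_apply, Bialgebra.comulAlgHom_apply]
    rw [heF, map_smul, hx.primitive, map_add, Algebra.TensorProduct.map_tmul,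
      Algebra.TensorProduct.map_tmul, heF, map_one, smul_add, TensorProduct.smul_tmul',
      TensorProduct.tmul_smul]

variable {A : Type*} [Ring A] [Algebra k A]

omit hx in
/-- The diagonal action on `A ⊗ A` of an action on `A`. -/
def diagonalAct (F : H →ₐ[k] Module.End k A) : H →ₐ[k] Module.End k (A ⊗[k] A) :=
  (Module.endTensorEndAlgHom (R := k) (S := k) (A := k) (M := A) (N := A)).comp
    ((Algebra.TensorProduct.map F F).comp (Bialgebra.comulAlgHom k H))

omit hx in
lemma diagonalAct_tmul (F : H →ₐ[k] Module.End k A) (h : H) (a b : A) :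
    diagonalAct F h (a ⊗ₜ b) =
      TensorProduct.map (F.toLinearMap.flip a) (F.toLinearMap.flip b) (comul (R := k) h) := by
  simp only [diagonalAct, AlgHom.comp_apply, Bialgebra.comulAlgHom_apply]
  generalize comul (R := k) h = z
  induction z with
  | zero => simp
  | add z w hz hw => simp only [map_add, LinearMap.add_apply, hz, hw]
  | tmul h l => rfl

/-- A derivation `D` with `D ^ q = D` is the action of `x` for a module algebra structure. -/
lemma exists_moduleAlgebra (D : Module.End k A) (hD : ∀ a b, D (a * b) = D a * b + a * D b)
    (hq : D ^ q = D) : ∃ S : ModuleAlgebra k H A, S.act x = D := by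
  obtain ⟨F, hF⟩ := hx.exists_algHom D hq
  have hD1 : D 1 = 0 := by simpa using hD 1 1
  -- The `h` for which the multiplication `A ⊗ A → A` intertwines the diagonal action with the
  -- action on `A` form a subalgebra, so the module algebra axiom need only be checked at `x`, where
  -- it is the Leibniz rule.
  let T₁ : Subalgebra k H :=
    { carrier := {h | ∀ z, F h (LinearMap.mul' k A z) = LinearMap.mul' k A (diagonalAct F h z)}
      mul_mem' := fun {a b} ha hb z => by
        rw [map_mul, map_mul, Module.End.mul_apply, Module.End.mul_apply, hb, ha]
      add_mem' := fun {a b} ha hb z => by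
        rw [map_add, map_add, LinearMap.add_apply, LinearMap.add_apply, map_add, hb, ha]
      algebraMap_mem' := fun c z => by
        rw [AlgHom.commutes, AlgHom.commutes, Module.algebraMap_end_apply,
          Module.algebraMap_end_apply, map_smul] }
  have hT₁ : x ∈ T₁ := fun z => by
    induction z with
    | zero => simp
    | add z w hz hw => simp only [map_add, hz, hw]
    | tmul a b =>
      rw [diagonalAct_tmul, hx.primitive]
      simp [hF, hD]
  let T₂ : Subalgebra k H :=
    { carrier := {h | F h 1 = algebraMap k A (counit (R := k) h)}
      mul_mem' := fun {a b} ha hb => by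
        simp only [Set.mem_ofPred_eq] at ha hb ⊢
        rw [map_mul, Module.End.mul_apply, hb, Algebra.algebraMap_eq_smul_one, map_smul, ha,
          Bialgebra.counit_mul, mul_comm, map_mul, Algebra.smul_def]
      add_mem' := fun {a b} ha hb => by
        simp only [Set.mem_ofPred_eq] at ha hb ⊢
        rw [map_add, LinearMap.add_apply, ha, hb, map_add, map_add]
      algebraMap_mem' := fun c => by
        simp [Algebra.algebraMap_eq_smul_one] }
  have hT₂ : x ∈ T₂ := by
    change F x 1 = _
    rw [hF, hD1, hx.primitive.counit_eq_zero, map_zero]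
  exact ⟨{ act := F
           act_one := Algebra.mem_of_adjoin_eq_top hx.adjoin_eq_top T₂ hT₂
           act_mul := fun h a b => by
            rw [← diagonalAct_tmul]
            exact Algebra.mem_of_adjoin_eq_top hx.adjoin_eq_top T₁ hT₁ h (a ⊗ₜ b) }, hF⟩

lemma moduleAlgebra_ext {S S' : ModuleAlgebra k H A} (h : S.act x = S'.act x) : S = S' :=
  ModuleAlgebra.ext (hx.algHom_ext h)

/-- A subspace stable under `x` is stable under `H`. -/
lemma act_mem (S : ModuleAlgebra k H A) (V : Submodule k A) (hV : ∀ a ∈ V, S.act x a ∈ V)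
    (h : H) : ∀ a ∈ V, S.act h a ∈ V :=
  Algebra.mem_of_adjoin_eq_top hx.adjoin_eq_top
    { carrier := {h | ∀ a ∈ V, S.act h a ∈ V}
      mul_mem' := fun {h l} hh hl a ha => by
        rw [map_mul]
        exact hh _ (hl a ha)
      add_mem' := fun {h l} hh hl a ha => by
        rw [map_add]
        exact V.add_mem (hh a ha) (hl a ha)
      algebraMap_mem' := fun c a ha => by
        rw [AlgHom.commutes]
        exact V.smul_mem c ha } hV h

/-- If `x` acts by zero then `H` acts through the counit. -/
lemma act_eq_counit_smul (S : ModuleAlgebra k H A) (hS : S.act x = 0) (h : H) (a : A) :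
    S.act h a = counit (R := k) h • a := by
  have : S.act = (Algebra.ofId k (Module.End k A)).comp (Bialgebra.counitAlgHom k H) :=
    hx.algHom_ext (by simp [hS, hx.primitive.counit_eq_zero])
  rw [this]
  rfl

end IsPrimitiveGenerator

end ModuleAlgebraGenerator

/-! ### Algebra maps out of a smash product -/

namespace SmashProduct

variable {k : Type*} [Field k] {H : Type*} [Ring H] [HopfAlgebra k H]
  {A : Type*} [Ring A] [Algebra k A] (S : ModuleAlgebra k H A)

/-- The embedding `h ↦ 1 # h` of `H` into `A # H`. -/
def inclH : H →ₐ[k] SmashProduct S :=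
  AlgHom.ofLinearMap ((toTensor S).symm.toLinearMap ∘ₗ TensorProduct.mk k A H 1) rfl
    (fun g h => by
      change mk S 1 (g * h) = mk S 1 g * mk S 1 h
      rw [mk_mul_mk S (ℛ k g)]
      simp only [S.act_one, one_mul]
      conv_lhs => rw [← Coalgebra.sum_counit_smul (ℛ k g)]
      rw [Finset.sum_mul]
      simp only [mk, ← map_sum, Algebra.algebraMap_eq_smul_one, TensorProduct.smul_tmul,
        ← TensorProduct.tmul_sum, smul_mul_assoc])

lemma inclH_apply (h : H) : inclH S h = mk S 1 h := rfl

lemma incl_mul_mk (a b : A) (h : H) : incl S a * mk S b h = mk S (a * b) h := by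
  rw [incl_apply, mk_mul_mk S (ι := Unit)
    { index := {()}, left := fun _ => (1 : H), right := fun _ => 1,
      eq := by simp [Algebra.TensorProduct.one_def] }]
  simp

lemma incl_mul_inclH (a : A) (h : H) : incl S a * inclH S h = mk S a h := by
  rw [inclH_apply, incl_mul_mk, mul_one]

lemma inclH_mul_incl {x : H} (hx : IsPrimitiveElement k x) (a : A) :
    inclH S x * incl S a = incl S (S.act x a) + incl S a * inclH S x := by
  obtain ⟨r, hr, h1, h2, h3, h4⟩ := hx.exists_repr
  rw [incl_mul_inclH, inclH_apply, incl_apply, incl_apply, mk_mul_mk S r, hr]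
  simp [h1, h2, h3, h4]

lemma coaction_incl (a : A) : coaction S (incl S a) = incl S a ⊗ₜ 1 :=
  ((isCleftExtension S).coinvariants _).mpr ⟨a, rfl⟩

lemma coaction_inclH {x : H} (hx : IsPrimitiveElement k x) :
    coaction S (inclH S x) = inclH S x ⊗ₜ 1 + 1 ⊗ₜ x := by
  obtain ⟨r, hr, h1, h2, h3, h4⟩ := hx.exists_repr
  rw [inclH_apply, coaction_mk S r, hr]
  simp [h1, h2, h3, h4, one_def]

lemma algHom_ext {x : H} (hx : Algebra.adjoin k {x} = ⊤) {C : Type*} [Semiring C] [Algebra k C]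
    {F F' : SmashProduct S →ₐ[k] C} (h₁ : ∀ a, F (incl S a) = F' (incl S a))
    (h₂ : F (inclH S x) = F' (inclH S x)) : F = F' := by
  have h : F.comp (inclH S) = F'.comp (inclH S) :=
    Algebra.algHom_ext_of_adjoin_eq_top hx h₂
  ext y
  induction y using induction_on with
  | zero => simp
  | add y z hy hz => rw [map_add, map_add, hy, hz]
  | mk a l =>
    rw [← incl_mul_inclH, map_mul, map_mul, h₁]
    congr 1
    exact DFunLike.congr_fun h l

section Lift

variable {B : Type*} [Ring B] [Algebra k B]

/-- The linear map `a # h ↦ j(a) θ(h)`. -/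
def liftLin (j : A →ₐ[k] B) (θ : H →ₐ[k] B) : A ⊗[k] H →ₗ[k] B :=
  LinearMap.mul' k B ∘ₗ TensorProduct.map j.toLinearMap θ.toLinearMap

@[simp] lemma liftLin_tmul (j : A →ₐ[k] B) (θ : H →ₐ[k] B) (a : A) (h : H) :
    liftLin j θ (a ⊗ₜ h) = j a * θ h := rfl

/-- Algebra maps `j : A → B`, `θ : H → B` with `θ(x) j(a) = j(x · a) + j(a) θ(x)` for a
primitive generator `x` of `H` induce an algebra map `A # H → B`. -/
lemma exists_lift {x : H} (hx : IsPrimitiveElement k x) (hgen : Algebra.adjoin k {x} = ⊤)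
    (j : A →ₐ[k] B) (θ : H →ₐ[k] B)
    (hcomm : ∀ a, θ x * j a = j (S.act x a) + j a * θ x) :
    ∃ Φ : SmashProduct S →ₐ[k] B, ∀ z, Φ z = liftLin j θ (toTensor S z) := by
  -- Multiplicativity amounts to `liftLin` turning the diagonal action of `h` into left
  -- multiplication by `θ h`. Such `h` form a subalgebra, and `hcomm` is the case `h = x`.
  let T : Subalgebra k H :=
    { carrier := {h | ∀ z, liftLin j θ (diag S h z) = θ h * liftLin j θ z}
      mul_mem' := fun {h l} hh hl z => by
        rw [map_mul, Module.End.mul_apply, hh, hl, map_mul, mul_assoc]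
      add_mem' := fun {h l} hh hl z => by
        rw [map_add, LinearMap.add_apply, map_add, hh, hl, map_add, add_mul]
      algebraMap_mem' := fun c z => by
        rw [AlgHom.commutes, AlgHom.commutes, Module.algebraMap_end_apply, map_smul,
          Algebra.smul_def] }
  have hT : x ∈ T := fun z => by
    obtain ⟨r, hr, h1, h2, h3, h4⟩ := hx.exists_repr
    induction z with
    | zero => simp
    | add z w hz hw => simp only [map_add, hz, hw, mul_add]
    | tmul a l =>
      rw [diag_tmul S r, hr]
      simp only [Fintype.sum_bool, h1, h2, h3, h4, map_one, one_mul, map_add, liftLin_tmul,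
        Module.End.one_apply, map_mul]
      rw [← mul_assoc, ← mul_assoc, hcomm, add_mul]
  have hall := Algebra.mem_of_adjoin_eq_top hgen T hT
  refine ⟨AlgHom.ofLinearMap (liftLin j θ ∘ₗ (toTensor S).toLinearMap) ?_ ?_, fun z => rfl⟩
  · change liftLin j θ (1 ⊗ₜ 1) = 1
    simp
  · intro y z
    change liftLin j θ (mulMap S (toTensor S y) (toTensor S z)) =
      liftLin j θ (toTensor S y) * liftLin j θ (toTensor S z)
    generalize toTensor S y = y
    generalize toTensor S z = z
    induction y with
    | zero => simp
    | add y y' hy hy' => simp only [map_add, LinearMap.add_apply, hy, hy', add_mul]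
    | tmul a h =>
      rw [mulMap_tmul, liftLin_tmul, mul_assoc, ← hall h z]
      generalize diag S h z = z
      induction z with
      | zero => simp
      | add y y' hy hy' => simp only [map_add, hy, hy', mul_add]
      | tmul b l => simp [mul_assoc]

end Lift

end SmashProduct

/-! ## Comodule algebras over the dual of a group algebra -/

section GroupAction

open HopfDual

variable {k : Type u} [Field k] {G : Type v} [Group G] [Fintype G]
  {B : Type*} [Ring B] [Algebra k B] (ρ : B →ₐ[k] B ⊗[k] HopfDual k (MonoidAlgebra k G))

/-- The action of `G` on a `k[G]^*`-comodule algebra. -/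
def groupAct (g : G) : B →ₐ[k] B := (slice k B g).comp ρ

lemma groupAct_apply (g : G) (b : B) : groupAct ρ g b = slice k B g (ρ b) := rfl

lemma groupAct_groupAct (hρ : IsComoduleAlgebra ρ) (g h : G) (b : B) :
    groupAct ρ g (groupAct ρ h b) = groupAct ρ (g * h) b := by
  -- `T` evaluates the two last factors at `g` and `h`; applied to coassociativity it gives the
  -- action law.
  let T : B ⊗[k] (HopfDual k (MonoidAlgebra k G) ⊗[k] HopfDual k (MonoidAlgebra k G)) →ₗ[k] B :=
    (TensorProduct.rid k B).toLinearMap ∘ₗ LinearMap.lTensor B (LinearMap.mul' k k ∘ₗ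
      TensorProduct.map (evalAt g).toLinearMap (evalAt h).toLinearMap)
  have h1 : ∀ z, T (TensorProduct.assoc k B _ _ (ρ.toLinearMap.rTensor _ z)) =
      slice k B g (ρ (slice k B h z)) := by
    intro z
    induction z with
    | zero => simp
    | add z w hz hw => simp only [map_add, hz, hw]
    | tmul b f =>
      rw [LinearMap.rTensor_tmul, slice_tmul, map_smul, map_smul, AlgHom.toLinearMap_apply]
      generalize ρ b = z
      induction z with
      | zero => simp
      | add z w hz hw => simp only [map_add, TensorProduct.add_tmul, hz, hw, smul_add]
      | tmul b f' => simp [T, smul_smul, mul_comm]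
  have h2 : ∀ z, T (LinearMap.lTensor B (comul (R := k)) z) = slice k B (g * h) z := by
    intro z
    induction z with
    | zero => simp
    | add z w hz hw => simp only [map_add, hz, hw]
    | tmul b f =>
      rw [slice_tmul, ← evalAt_comul]
      simp [T]
  rw [groupAct_apply, groupAct_apply, groupAct_apply, ← h1, hρ.coassoc, h2]

/-- The coaction is `ρ(b) = ∑ (g · b) ⊗ δ_g`, and `∑ δ_g = 1`. -/
lemma coinvariant_iff_groupAct (b : B) : ρ b = b ⊗ₜ 1 ↔ ∀ g, groupAct ρ g b = b := by
  constructor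
  · intro h g
    rw [groupAct_apply, h, slice_tmul, map_one, one_smul]
  · intro h
    rw [← sum_slice_tmul_delta (ρ b)]
    conv_lhs =>
      enter [2, g]
      rw [← groupAct_apply, h g]
    rw [← TensorProduct.tmul_sum, sum_delta]

variable {ρ} {θ : HopfDual k (MonoidAlgebra k G) →ₐ[k] B}

/-- Colinearity of `θ` makes it equivariant for right translation of functions, and `a h = g` means
`a = g h⁻¹`. -/
lemma groupAct_delta (hθ : ∀ f, ρ (θ f) = θ.toLinearMap.rTensor _ (comul (R := k) f)) (g h : G) :
    groupAct ρ h (θ (delta g)) = θ (delta (g * h⁻¹)) := by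
  classical
  have h1 : ∀ z, slice k B h (θ.toLinearMap.rTensor _ z) =
      θ (slice k (HopfDual k (MonoidAlgebra k G)) h z) := by
    intro z
    induction z with
    | zero => simp
    | add z w hz hw => simp only [map_add, hz, hw]
    | tmul b f => simp
  have h2 : ∀ (a : G) z, evalAt a (slice k (HopfDual k (MonoidAlgebra k G)) h z) =
      LinearMap.mul' k k (TensorProduct.map (evalAt a).toLinearMap (evalAt h).toLinearMap z) := by
    intro a z
    induction z with
    | zero => simp
    | add z w hz hw => simp only [map_add, hz, hw]
    | tmul b f => simp [mul_comm]
  rw [groupAct_apply, hθ, h1]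
  congr 1
  apply ext_evalAt
  intro a
  rw [h2, evalAt_comul, evalAt_delta, evalAt_delta]
  simp only [eq_mul_inv_iff_mul_eq]

variable {A : Type*} [Ring A] [Algebra k A] {ι : A →ₐ[k] B}

/-- A comodule algebra map `θ : k[G]^* → B` splits `B` as `A ⊗ k[G]^*`, where `A` is the algebra of
coinvariants. -/
theorem bijective_liftLin (hρ : IsComoduleAlgebra ρ) (hι : Function.Injective ι)
    (hco : ∀ b : B, ρ b = b ⊗ₜ[k] 1 ↔ b ∈ Set.range ι)
    (hθ : ∀ f, ρ (θ f) = θ.toLinearMap.rTensor _ (comul (R := k) f)) :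
    Function.Bijective (SmashProduct.liftLin ι θ) := by
  classical
  have hιinv : ∀ g a, groupAct ρ g (ι a) = ι a := fun g a =>
    (coinvariant_iff_groupAct ρ _).mp ((hco _).mpr ⟨a, rfl⟩) g
  have hsum : ∑ g : G, θ (delta g) = 1 := by rw [← map_sum, sum_delta, map_one]
  constructor
  · rw [injective_iff_map_eq_zero]
    intro z hz
    have hz' := hz
    rw [← sum_slice_tmul_delta z, map_sum] at hz'
    simp only [SmashProduct.liftLin_tmul] at hz'
    -- The `θ(δ_g)` are orthogonal idempotents, so right multiplication by one of them isolates its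
    -- term.
    have h1 : ∀ g, ι (slice k A g z) * θ (delta g) = 0 := by
      intro g
      have := congrArg (· * θ (delta g)) hz'
      simp only [Finset.sum_mul, zero_mul, mul_assoc, ← map_mul] at this
      rw [Finset.sum_eq_single g, delta_mul_delta_self] at this
      · exact this
      · intro h _ hne
        rw [delta_mul_delta_of_ne hne, map_zero, mul_zero]
      · simp
    have h2 : ∀ g, slice k A g z = 0 := by
      intro g
      apply hι
      -- The coefficient is invariant, and the translates of `θ(δ_g)` run through all the
      -- idempotents, with sum `1`.
      have h3 : ∑ h : G, groupAct ρ h (ι (slice k A g z) * θ (delta g)) = ι (slice k A g z) := by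
        simp only [map_mul, hιinv, groupAct_delta hθ, ← Finset.mul_sum]
        rw [← Fintype.sum_equiv ((Equiv.inv G).trans (Equiv.mulLeft g)) (fun h => θ (delta (g * h⁻¹)))
          (fun h => θ (delta h)) (fun h => rfl)] at hsum
        rw [hsum, mul_one]
      rw [← h3, h1]
      simp
    rw [← sum_slice_tmul_delta z]
    simp [h2]
  · intro b
    -- The trace over `G` of `b θ(δ_g)` is invariant; it is the coefficient of `δ_g` in the preimage
    -- of `b`.
    have h1 : ∀ g : G, ∃ a, ι a = ∑ h : G, groupAct ρ h (b * θ (delta g)) := by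
      intro g
      apply (hco _).mp
      rw [coinvariant_iff_groupAct]
      intro h
      rw [map_sum]
      simp only [groupAct_groupAct ρ hρ]
      exact Fintype.sum_equiv (Equiv.mulLeft h) _ _ (fun _ => rfl)
    choose a ha using h1
    refine ⟨∑ g, a g ⊗ₜ delta g, ?_⟩
    rw [map_sum]
    -- In the trace multiplied by `θ(δ_g)`, the term of `h` contains `θ(δ_{g h⁻¹}) θ(δ_g)`, so only
    -- `h = 1` survives.
    have h2 : ∀ g, ι (a g) * θ (delta g) = b * θ (delta g) := by
      intro g
      rw [ha, Finset.sum_mul, Finset.sum_eq_single 1]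
      · rw [map_mul, groupAct_delta hθ, mul_assoc, ← map_mul]
        simp only [inv_one, mul_one, delta_mul_delta_self]
        have : groupAct ρ 1 b = b := by
          have := hρ.counit b
          have h3 : ∀ z : B ⊗[k] HopfDual k (MonoidAlgebra k G), slice k B 1 z =
              TensorProduct.rid k B ((counit (R := k)).lTensor B z) := by
            intro z
            induction z with
            | zero => simp
            | add z w hz hw => simp only [map_add, hz, hw]
            | tmul b f =>
              rw [slice_tmul]
              rfl
          rw [groupAct_apply, h3, this]
          simp
        rw [this]
      · intro h _ hne
        rw [map_mul, groupAct_delta hθ, mul_assoc, ← map_mul, delta_mul_delta_of_ne, map_zero,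
          mul_zero]
        simpa using hne
      · simp
    simp only [SmashProduct.liftLin_tmul, h2]
    rw [← Finset.mul_sum, hsum, mul_one]

end GroupAction

/-! ## Primitive elements in cleft extensions -/

section PrimitiveLift

/-- Artin–Schreier equations are solvable in local algebras. -/
lemma exists_pow_sub_self {p : ℕ} [Fact p.Prime] {n : ℕ} (hn : n ≠ 0) {k : Type*} [Field k]
    [IsAlgClosed k] [CharP k p] {A : Type*} [CommRing A] [Algebra k A] [FiniteDimensional k A]
    [IsLocalRing A] (c : A) : ∃ a ∈ Algebra.adjoin k {c}, c + a ^ p ^ n = a := by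
  have : CharP A p := charP_of_injective_algebraMap (algebraMap k A).injective p
  have hq : 1 < p ^ n := Nat.one_lt_pow hn (Fact.out : p.Prime).one_lt
  -- Split `c` into a scalar and a nilpotent part and solve the equation for each; the Frobenius
  -- power is additive.
  obtain ⟨c₀, hc₀⟩ := spectrum.nonempty_of_isAlgClosed_of_finiteDimensional k c
  have hc₁ : IsNilpotent (c - algebraMap k A c₀) := by
    have : IsArtinianRing A := IsArtinianRing.of_finite k A
    have h : ¬ IsUnit (c - algebraMap k A c₀) := by
      rw [← IsUnit.neg_iff, neg_sub]
      exact hc₀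
    exact Ring.KrullDimLE.isNilpotent_iff_mem_nonunits.mpr h
  obtain ⟨a₀, ha₀⟩ : ∃ a₀ : k, c₀ + a₀ ^ p ^ n = a₀ := by
    have hdeg : (Polynomial.X - Polynomial.C c₀ : Polynomial k).degree < (p ^ n : ℕ) := by
      rw [Polynomial.degree_X_sub_C]
      exact_mod_cast hq
    obtain ⟨a₀, ha₀⟩ := IsAlgClosed.exists_root
      (Polynomial.X ^ p ^ n - (Polynomial.X - Polynomial.C c₀) : Polynomial k) (by
        rw [Polynomial.degree_sub_eq_left_of_degree_lt (by rwa [Polynomial.degree_X_pow]),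
          Polynomial.degree_X_pow]
        exact_mod_cast (by omega : p ^ n ≠ 0))
    refine ⟨a₀, ?_⟩
    simp only [Polynomial.IsRoot, Polynomial.eval_sub, Polynomial.eval_pow, Polynomial.eval_X,
      Polynomial.eval_C] at ha₀
    linear_combination ha₀
  set c₁ := c - algebraMap k A c₀ with hc₁def
  obtain ⟨N, hN⟩ := hc₁
  have hmem : c₁ ∈ Algebra.adjoin k {c} :=
    sub_mem (Algebra.self_mem_adjoin_singleton k c) (Subalgebra.algebraMap_mem _ _)
  -- For the nilpotent part `c₁`, the series `∑ c₁ ^ (q ^ i)` telescopes in `a - a ^ q` to `c₁`, and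
  -- it stops because `c₁ ^ (q ^ N) = 0`.
  refine ⟨algebraMap k A a₀ + ∑ i ∈ Finset.range N, c₁ ^ (p ^ n) ^ i,
    add_mem (Subalgebra.algebraMap_mem _ _) (sum_mem fun i _ => pow_mem hmem _), ?_⟩
  have h1 : (∑ i ∈ Finset.range N, c₁ ^ (p ^ n) ^ i) ^ p ^ n =
      ∑ i ∈ Finset.range N, c₁ ^ (p ^ n) ^ (i + 1) := by
    rw [sum_pow_char_pow]
    refine Finset.sum_congr rfl fun i _ => ?_
    rw [← pow_mul, ← pow_succ]
  have h2 : c₁ ^ (p ^ n) ^ N = 0 :=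
    pow_eq_zero_of_le (Nat.lt_pow_self hq).le hN
  have h3 := Finset.sum_range_succ (fun i => c₁ ^ (p ^ n) ^ i) N
  rw [Finset.sum_range_succ', h2] at h3
  simp only [pow_zero, pow_one, add_zero] at h3
  rw [add_pow_char_pow, h1, ← map_pow]
  have h4 := congrArg (algebraMap k A) ha₀
  rw [map_add] at h4
  linear_combination h4 + h3 - hc₁def

variable {k : Type*} [Field k] {H : Type*} [Ring H] [HopfAlgebra k H]
  {B : Type*} [Ring B] [Algebra k B] {ρ : B →ₐ[k] B ⊗[k] H} {x : H}

/-- A cleft extension contains an element `y` with `ρ(y) = y ⊗ 1 + 1 ⊗ x`. -/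
lemma IsCleftExtension.exists_coaction_eq {A : Type*} [Ring A] [Algebra k A] {ι : A →ₐ[k] B}
    (hB : IsCleftExtension ι ρ) (hx : IsPrimitiveElement k x) :
    ∃ y, ρ y = y ⊗ₜ 1 + 1 ⊗ₜ x := by
  obtain ⟨γ, hγ, hu⟩ := hB.exists_cleft_map
  obtain ⟨γ', h1, h2⟩ := isUnit_iff_exists.mp hu
  let r : Coalgebra.Repr k (1 : H) Unit :=
    { index := {()}, left := fun _ => (1 : H), right := fun _ => 1,
      eq := by simp [Algebra.TensorProduct.one_def] }
  have e1 : γ 1 * γ' 1 = 1 := by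
    have h3 := congrArg (fun f : WithConv (H →ₗ[k] B) => f 1) h1
    simp only [r.convMul_apply] at h3
    simpa [r] using h3
  have e2 : γ' 1 * γ 1 = 1 := by
    have h3 := congrArg (fun f : WithConv (H →ₗ[k] B) => f 1) h2
    simp only [r.convMul_apply] at h3
    simpa [r] using h3
  have e3 : ρ (γ 1) = γ 1 ⊗ₜ 1 := by
    rw [hγ, Bialgebra.comul_one, Algebra.TensorProduct.one_def, LinearMap.rTensor_tmul]
  -- Both sides are inverse to `γ 1 ⊗ 1`.
  have e4 : ρ (γ' 1) = γ' 1 ⊗ₜ 1 := by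
    have h3 : (γ' 1 ⊗ₜ (1 : H)) * ρ (γ 1) = 1 := by
      rw [e3, Algebra.TensorProduct.tmul_mul_tmul, e2, one_mul, Algebra.TensorProduct.one_def]
    have h4 : ρ (γ 1) * ρ (γ' 1) = 1 := by rw [← map_mul, e1, map_one]
    exact (left_inv_eq_right_inv h3 h4).symm
  -- Since `ρ(γ x) = γ x ⊗ 1 + γ 1 ⊗ x`, dividing by the coinvariant unit `γ 1` normalises the
  -- second term.
  refine ⟨γ' 1 * γ x, ?_⟩
  rw [map_mul, e4, hγ, hx, map_add, LinearMap.rTensor_tmul, LinearMap.rTensor_tmul, mul_add,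
    Algebra.TensorProduct.tmul_mul_tmul, Algebra.TensorProduct.tmul_mul_tmul, e2, one_mul, one_mul]

variable {p : ℕ} [Fact p.Prime] {n : ℕ} {A : Type*} [CommRing A] [Algebra k A] {ι : A →ₐ[k] B}

/-- The summand `1 ⊗ x` of `ρ(y)` commutes with `ι a ⊗ 1`, so it drops out of the coaction of the
commutator. -/
lemma IsCleftExtension.exists_commutator (hB : IsCleftExtension ι ρ) {y : B}
    (hy : ρ y = y ⊗ₜ 1 + 1 ⊗ₜ x) (a : A) : ∃ a', ι a' = y * ι a - ι a * y := by
  apply (hB.coinvariants _).mp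
  have h1 : ρ (ι a) = ι a ⊗ₜ 1 := (hB.coinvariants _).mpr ⟨a, rfl⟩
  rw [map_sub, map_mul, map_mul, h1, hy]
  simp [add_mul, mul_add, TensorProduct.sub_tmul]

/-- In a cleft extension of a local algebra the element `y` can be chosen with `y ^ q = y`. -/
theorem IsCleftExtension.exists_coaction_eq_pow_eq [IsAlgClosed k] [CharP k p]
    [FiniteDimensional k A] [IsLocalRing A] (hB : IsCleftExtension ι ρ) (hn : n ≠ 0)
    (hx : IsPrimitiveElement k x) (hpow : x ^ p ^ n = x) :
    ∃ y, ρ y = y ⊗ₜ 1 + 1 ⊗ₜ x ∧ y ^ p ^ n = y := by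
  have hA : Nontrivial B := hB.injective.nontrivial
  have hBp : CharP B p := charP_of_injective_algebraMap (algebraMap k B).injective p
  have hBH : CharP (B ⊗[k] H) p := by
    have : Nontrivial H := ⟨0, 1, fun h => by
      have := congrArg (counit (R := k)) h
      simp at this⟩
    exact charP_of_injective_algebraMap (algebraMap k (B ⊗[k] H)).injective p
  obtain ⟨y, hy⟩ := hB.exists_coaction_eq hx
  -- As `y ⊗ 1` and `1 ⊗ x` commute and `x ^ q = x`, the term `1 ⊗ x` cancels in `ρ(y ^ q - y)`.
  obtain ⟨c, hc⟩ : ∃ c, ι c = y ^ p ^ n - y := by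
    apply (hB.coinvariants _).mp
    have hcomm : Commute (y ⊗ₜ[k] (1 : H)) (1 ⊗ₜ x) := by
      simp [Commute, SemiconjBy]
    rw [map_sub, map_pow, hy, add_pow_char_pow_of_commute _ _ hcomm,
      Algebra.TensorProduct.tmul_pow, Algebra.TensorProduct.tmul_pow, one_pow, one_pow, hpow,
      TensorProduct.sub_tmul]
    abel
  obtain ⟨a, ha, hac⟩ := exists_pow_sub_self (p := p) hn (k := k) c
  -- `B` need not be commutative, but `y` commutes with `ι c = y ^ q - y`, hence with `ι` of every
  -- polynomial in `c`. This is why the Artin–Schreier solution is taken in the subalgebra generated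
  -- by `c`.
  have hya : Commute y (ι a) := by
    have : a ∈ (Subalgebra.centralizer k {y}).comap ι := by
      refine (Algebra.adjoin_le ?_ : Algebra.adjoin k {c} ≤ _) ha
      rw [Set.singleton_subset_iff]
      change ι c ∈ Subalgebra.centralizer k {y}
      rw [Subalgebra.mem_centralizer_iff]
      intro z hz
      rw [Set.mem_singleton_iff.mp hz, hc, mul_sub, sub_mul, ← pow_succ, ← pow_succ']
    exact (Subalgebra.mem_centralizer_iff k).mp this y rfl
  have h1 : ρ (ι a) = ι a ⊗ₜ 1 := (hB.coinvariants _).mpr ⟨a, rfl⟩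
  refine ⟨y + ι a, ?_, ?_⟩
  · rw [map_add, hy, h1, TensorProduct.add_tmul]
    abel
  · rw [add_pow_char_pow_of_commute _ _ hya, ← map_pow, eq_add_of_sub_eq hc.symm, add_right_comm,
      ← map_add, hac, add_comm]

/-- The derivation of `A` given by the commutator with `y`. -/
theorem IsCleftExtension.exists_derivation [CharP k p] [Nontrivial A] (hB : IsCleftExtension ι ρ)
    {y : B} (hy : ρ y = y ⊗ₜ 1 + 1 ⊗ₜ x) (hpow : y ^ p ^ n = y) :
    ∃ D : Module.End k A, (∀ a, ι (D a) = y * ι a - ι a * y) ∧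
      (∀ a b, D (a * b) = D a * b + a * D b) ∧ D ^ p ^ n = D := by
  have hA : Nontrivial B := hB.injective.nontrivial
  have hEp : CharP (Module.End k B) p :=
    charP_of_injective_algebraMap (algebraMap k (Module.End k B)).injective p
  choose D hD using fun a => hB.exists_commutator hy a
  let D' : Module.End k A :=
    { toFun := D
      map_add' := fun a b => hB.injective (by
        rw [map_add, hD, hD, hD, map_add, mul_add, add_mul]
        abel)
      map_smul' := fun c a => hB.injective (by
        rw [RingHom.id_apply, map_smul, hD, hD, map_smul, mul_smul_comm, smul_mul_assoc,
          smul_sub]) }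
  have hD' : ∀ a, ι (D' a) = y * ι a - ι a * y := hD
  refine ⟨D', hD', fun a b => hB.injective ?_, ?_⟩
  · rw [hD', map_add ι, map_mul ι, map_mul ι, map_mul ι, hD', hD']
    noncomm_ring
  -- `D` is the restriction of `ad y = L_y - R_y`. As `L_y` and `R_y` commute, its `q`-th power is
  -- `ad (y ^ q) = ad y`.
  · let E : Module.End k B := LinearMap.mulLeft k y - LinearMap.mulRight k y
    have hE : E ^ p ^ n = E := by
      rw [sub_pow_char_pow_of_commute _ _ (LinearMap.commute_mulLeft_right y y),
        LinearMap.pow_mulLeft, LinearMap.pow_mulRight, hpow]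
    have hEι : ∀ m a, ι ((D' ^ m) a) = (E ^ m) (ι a) := by
      intro m
      induction m with
      | zero => simp
      | succ m ih =>
        intro a
        rw [pow_succ, pow_succ, Module.End.mul_apply, Module.End.mul_apply, ih, hD']
        rfl
    ext a
    apply hB.injective
    rw [hEι, hE, hD']
    rfl

end PrimitiveLift

/-! ## Constructing twist equivalences -/

section TwistEquivalence

variable {k : Type u} [Field k] {G : Type v} [Group G] [Fintype G]
  {B : Type*} [Ring B] [Algebra k B] {ρ : B →ₐ[k] B ⊗[k] HopfDual k (MonoidAlgebra k G)}
  {A : Type*} [Ring A] [Algebra k A] {ι : A →ₐ[k] B}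

/-- A cleft extension `B` of `A` is twist equivalent to `A # H` if it contains `y` with
`ρ(y) = y ⊗ 1 + 1 ⊗ x`, `y ^ q = y`, such that the commutator with `y` is conjugate to a multiple of
the action of `x`. -/
theorem IsCleftExtension.twistEquivalent {q : ℕ} {x : HopfDual k (MonoidAlgebra k G)}
    (hx : IsPrimitiveGenerator k q x) (hB : IsCleftExtension ι ρ) {y : B}
    (hy : ρ y = y ⊗ₜ 1 + 1 ⊗ₜ x) (hpow : y ^ q = y) {c : k} (hc : c ^ q = c) (hc0 : c ≠ 0)
    (φ : A ≃ₐ[k] A) (S : ModuleAlgebra k (HopfDual k (MonoidAlgebra k G)) A)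
    (hS : ∀ a, y * ι (φ.symm a) - ι (φ.symm a) * y = c • ι (φ.symm (S.act x a))) :
    TwistEquivalent ι ρ (SmashProduct.incl S) (SmashProduct.coaction S) := by
  obtain ⟨θ₀, hθ₀⟩ := hx.exists_algHom y hpow
  -- The commutator with `y` is conjugate to `c` times the action of `x`; replacing `y` by `c⁻¹ y`
  -- removes the factor, at the cost of the Hopf automorphism `x ↦ c⁻¹ x`.
  obtain ⟨ψ, hψ⟩ := hx.exists_scaling (c := c⁻¹) (by rw [inv_pow, hc]) (inv_ne_zero hc0)
  have hcol : ∀ f, ρ (θ₀ f) = θ₀.toLinearMap.rTensor _ (comul (R := k) f) := by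
    have : ρ.comp θ₀ = (Algebra.TensorProduct.map θ₀ (AlgHom.id k _)).comp
        (Bialgebra.comulAlgHom k _) := hx.algHom_ext (by
      simp only [AlgHom.comp_apply, Bialgebra.comulAlgHom_apply]
      rw [hx.primitive, hθ₀, hy]
      simp [hθ₀])
    exact fun f => DFunLike.congr_fun this f
  have hbij := bijective_liftLin hB.isComoduleAlgebra hB.injective hB.coinvariants hcol
  let ψ' : HopfDual k (MonoidAlgebra k G) ≃ₐ[k] HopfDual k (MonoidAlgebra k G) := ψ
  have hψ' : ψ' x = c⁻¹ • x := hψ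
  let j : A →ₐ[k] B := ι.comp φ.symm.toAlgHom
  let θ : HopfDual k (MonoidAlgebra k G) →ₐ[k] B := θ₀.comp ψ'.toAlgHom
  have hθ : θ x = c⁻¹ • y := by
    change θ₀ (ψ' x) = _
    rw [hψ', map_smul, hθ₀]
  have hj : ∀ a, j a = ι (φ.symm a) := fun _ => rfl
  obtain ⟨Φ, hΦ⟩ := SmashProduct.exists_lift S hx.primitive hx.adjoin_eq_top j θ (fun a => by
    have h1 := congrArg (c⁻¹ • ·) (hS a)
    simp only [smul_smul, inv_mul_cancel₀ hc0, one_smul, smul_sub] at h1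
    rw [hθ, hj, hj, smul_mul_assoc, mul_smul_comm, ← h1]
    abel)
  have hΦbij : Function.Bijective Φ := by
    -- `Φ` is the splitting `A ⊗ H → B` given by `θ₀`, preceded by the bijection `φ⁻¹ ⊗ ψ`.
    have h1 : ∀ z, Φ z = SmashProduct.liftLin ι θ₀
        (TensorProduct.congr φ.symm.toLinearEquiv ψ'.toLinearEquiv (SmashProduct.toTensor S z)) := by
      intro z
      rw [hΦ]
      generalize SmashProduct.toTensor S z = z
      induction z with
      | zero => simp
      | add z w hz hw => simp only [map_add, hz, hw]
      | tmul a f => rfl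
    have h2 : ⇑Φ = SmashProduct.liftLin ι θ₀ ∘
        (TensorProduct.congr φ.symm.toLinearEquiv ψ'.toLinearEquiv) ∘
        (SmashProduct.toTensor S) := funext h1
    rw [h2]
    exact hbij.comp ((LinearEquiv.bijective _).comp (LinearEquiv.bijective _))
  let e := AlgEquiv.ofBijective Φ hΦbij
  have he : ∀ z, e z = Φ z := fun _ => rfl
  have hincl : ∀ a, Φ (SmashProduct.incl S a) = ι (φ.symm a) := by
    intro a
    rw [hΦ]
    change j a * θ 1 = _
    rw [map_one, mul_one]
    rfl
  have hinclH : ∀ h, Φ (SmashProduct.inclH S h) = θ h := by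
    intro h
    rw [hΦ]
    change j 1 * θ h = _
    rw [map_one, one_mul]
  refine ⟨φ, ψ, e.symm, fun a b => ?_, fun b => ?_⟩
  · apply e.injective
    rw [AlgEquiv.apply_symm_apply, map_mul e, AlgEquiv.apply_symm_apply, he, hincl,
      AlgEquiv.symm_apply_apply]
  · obtain ⟨s, rfl⟩ := e.surjective b
    rw [AlgEquiv.symm_apply_apply]
    have key : (Algebra.TensorProduct.map Φ ψ'.toAlgHom).comp (SmashProduct.coaction S) =
        ρ.comp Φ := SmashProduct.algHom_ext S hx.adjoin_eq_top
      (fun a => by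
        simp only [AlgHom.comp_apply, SmashProduct.coaction_incl, Algebra.TensorProduct.map_tmul,
          map_one, hincl]
        exact ((hB.coinvariants _).mpr ⟨_, rfl⟩).symm)
      (by
        simp only [AlgHom.comp_apply, SmashProduct.coaction_inclH S hx.primitive, map_add,
          Algebra.TensorProduct.map_tmul, map_one, hinclH, hθ, map_smul, hy]
        change _ + 1 ⊗ₜ ψ' x = _
        rw [hψ', smul_add, TensorProduct.tmul_smul, TensorProduct.smul_tmul',
          TensorProduct.smul_tmul'])
    have key' := DFunLike.congr_fun key s
    simp only [AlgHom.comp_apply] at key'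
    rw [he, ← key']
    generalize SmashProduct.coaction S s = z
    induction z with
    | zero => simp
    | add z w hz hw => simp only [map_add, hz, hw]
    | tmul s h =>
      simp only [LinearMap.lTensor_tmul, Algebra.TensorProduct.map_tmul, LinearMap.rTensor_tmul]
      change s ⊗ₜ[k] _ = e.symm (e s) ⊗ₜ[k] _
      rw [AlgEquiv.symm_apply_apply]
      rfl

end TwistEquivalence

/-! ## Local algebras with a nilpotent generator -/

section NilpotentGenerator

open Polynomial

variable {k : Type*} [Field k] {A : Type*} [CommRing A] [Algebra k A] {t : A}

/-- Two derivations agreeing on a generator are equal. -/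
lemma derivation_ext (hgen : Algebra.adjoin k {t} = ⊤) {D D' : Module.End k A}
    (hD : ∀ a b, D (a * b) = D a * b + a * D b) (hD' : ∀ a b, D' (a * b) = D' a * b + a * D' b)
    (h : D t = D' t) : D = D' := by
  have hD1 : D 1 = 0 := by simpa using hD 1 1
  have hD1' : D' 1 = 0 := by simpa using hD' 1 1
  ext a
  exact Algebra.mem_of_adjoin_eq_top hgen
    { carrier := {a | D a = D' a}
      mul_mem' := fun {a b} ha hb => by
        simp only [Set.mem_ofPred_eq] at ha hb ⊢
        rw [hD, hD', ha, hb]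
      add_mem' := fun {a b} ha hb => by
        simp only [Set.mem_ofPred_eq] at ha hb ⊢
        rw [map_add, map_add, ha, hb]
      algebraMap_mem' := fun c => by
        simp [Algebra.algebraMap_eq_smul_one, hD1, hD1'] } h a

/-- At `i = 0` the truncated exponent is harmless because its coefficient vanishes. -/
lemma derivation_pow {D : Module.End k A} (hD : ∀ a b, D (a * b) = D a * b + a * D b) (s : A)
    (i : ℕ) : D (s ^ i) = i * s ^ (i - 1) * D s := by
  have hD1 : D 1 = 0 := by simpa using hD 1 1
  induction i with
  | zero => simp [hD1]
  | succ i ih =>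
    rw [pow_succ, hD, ih]
    rcases i with _ | i
    · simp
    · simp only [Nat.add_sub_cancel]
      push_cast
      ring

/-- If `D(s) = s` for a generator `s`, then `D ^ (p ^ n) = D` in characteristic `p`. -/
lemma derivation_pow_char_eq {p : ℕ} [Fact p.Prime] [CharP k p] (n : ℕ)
    {s : A} (hgen : Algebra.adjoin k {s} = ⊤) {D : Module.End k A}
    (hD : ∀ a b, D (a * b) = D a * b + a * D b) (hs : D s = s) : D ^ p ^ n = D := by
  have h1 : ∀ i : ℕ, D (s ^ i) = (i : k) • s ^ i := by
    intro i
    rw [derivation_pow hD, hs, Algebra.smul_def, map_natCast]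
    rcases i with _ | i
    · simp
    · rw [Nat.add_sub_cancel, pow_succ, mul_assoc]
  have h2 : ∀ m i : ℕ, (D ^ m) (s ^ i) = (i : k) ^ m • s ^ i := by
    intro m i
    induction m with
    | zero => simp
    | succ m ih => rw [pow_succ', Module.End.mul_apply, ih, map_smul, h1, smul_smul, pow_succ]
  -- The eigenvalue of `D` on `s ^ i` lies in the prime field, which Frobenius fixes.
  have h3 : ∀ i : ℕ, (i : k) ^ p ^ n = i := fun i => map_natCast (iterateFrobenius k p n) i
  ext a
  obtain ⟨P, rfl⟩ := Algebra.aeval_surjective_of_adjoin_eq_top hgen a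
  induction P using Polynomial.induction_on' with
  | add P Q hP hQ => simp only [map_add, hP, hQ]
  | monomial i c =>
    rw [aeval_monomial, ← Algebra.smul_def, map_smul, map_smul, h2, h1, h3]

variable (hgen : Algebra.adjoin k {t} = ⊤)
include hgen

lemma exists_eq_algebraMap_add_mul (a : A) : ∃ (c : k) (b : A), a = algebraMap k A c + t * b :=
  Algebra.mem_of_adjoin_eq_top hgen
    { carrier := {a | ∃ (c : k) (b : A), a = algebraMap k A c + t * b}
      mul_mem' := by
        rintro _ _ ⟨c, b, rfl⟩ ⟨c', b', rfl⟩
        exact ⟨c * c', algebraMap k A c * b' + b * algebraMap k A c' + b * (t * b'), by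
          rw [map_mul]; ring⟩
      add_mem' := by
        rintro _ _ ⟨c, b, rfl⟩ ⟨c', b', rfl⟩
        exact ⟨c + c', b + b', by rw [map_add]; ring⟩
      algebraMap_mem' := fun c => ⟨c, 0, by simp⟩ } ⟨0, 1, by simp⟩ a

lemma adjoin_add_one_eq_top : Algebra.adjoin k {t + 1} = ⊤ := by
  rw [eq_top_iff, ← hgen]
  refine Algebra.adjoin_le (Set.singleton_subset_iff.mpr ?_)
  have := sub_mem (Algebra.self_mem_adjoin_singleton k (t + 1)) (one_mem _)
  simpa using this

/-- The algebra `A` is a quotient of `k[X]/(X ^ N)`. This serves to show `t ^ (dim A - 1) ≠ 0`. -/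
lemma finrank_le_of_pow_eq_zero {N : ℕ} (hN : t ^ N = 0) : Module.finrank k A ≤ N := by
  let e : k[X] ⧸ Ideal.span {(X ^ N : k[X])} →ₐ[k] A := Ideal.Quotient.liftₐ _ (aeval t)
    (Algebra.aeval_eq_zero_of_mem_span (by simp [hN]))
  have hsurj : Function.Surjective e := fun y => by
    obtain ⟨a, ha⟩ := Algebra.aeval_surjective_of_adjoin_eq_top hgen y
    exact ⟨Ideal.Quotient.mk _ a, ha⟩
  have hmonic : (X ^ N : k[X]).Monic := monic_X_pow N
  have hfd : FiniteDimensional k (k[X] ⧸ Ideal.span {(X ^ N : k[X])}) :=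
    (AdjoinRoot.powerBasis' hmonic).finite
  have hrank : Module.finrank k (k[X] ⧸ Ideal.span {(X ^ N : k[X])}) = N := by
    have h : Module.finrank k (k[X] ⧸ Ideal.span {(X ^ N : k[X])}) = (X ^ N : k[X]).natDegree :=
      (AdjoinRoot.powerBasis' hmonic).finrank
    rw [h, natDegree_X_pow]
  exact hrank ▸ e.toLinearMap.finrank_le_finrank_of_surjective hsurj

variable (ht : IsNilpotent t)
include ht

omit hgen in
lemma isNilpotent_mul_left (b : A) : IsNilpotent (t * b) :=
  (Commute.all t b).isNilpotent_mul_right ht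

omit hgen in
-- Multiplication by `t` is a nilpotent operator, so its characteristic polynomial is a power of
-- `X`, and Cayley–Hamilton applies.
lemma pow_finrank_eq_zero [FiniteDimensional k A] : t ^ Module.finrank k A = 0 := by
  have h1 : IsNilpotent (Algebra.lmul k A t) := ht.map _
  have h2 := LinearMap.aeval_self_charpoly (Algebra.lmul k A t)
  rw [h1.charpoly_eq_X_pow_finrank, map_pow, aeval_X, ← map_pow] at h2
  simpa using DFunLike.congr_fun h2 1

omit hgen in
lemma isUnit_algebraMap_add_mul {c : k} (hc : c ≠ 0) (b : A) :
    IsUnit (algebraMap k A c + t * b) :=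
  (isNilpotent_mul_left ht b).isUnit_add_left_of_commute ((IsUnit.mk0 c hc).map (algebraMap k A))
    (Commute.all _ _)

omit hgen in
lemma eq_zero_of_algebraMap_add_mul [Nontrivial A] {c : k} {b b' : A}
    (h : algebraMap k A c + t * b = t * b') : c = 0 := by
  by_contra hc
  have h1 := isUnit_algebraMap_add_mul ht hc b
  rw [h] at h1
  exact (isNilpotent_mul_left ht b').not_isUnit h1

/-- A unit multiple of the generator is the image of the generator under an automorphism. -/
lemma exists_algEquiv [FiniteDimensional k A] {w b : A} (hw : w = t * b) (hb : IsUnit b) :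
    ∃ φ : A ≃ₐ[k] A, φ t = w := by
  have hwn : w ^ Module.finrank k A = 0 := by
    rw [hw, mul_pow, pow_finrank_eq_zero ht, zero_mul]
  obtain ⟨F, hF⟩ := Algebra.exists_algHom_of_adjoin_eq_top hgen
    (monic_X_pow (Module.finrank k A)) (natDegree_X_pow _)
    (by simp [pow_finrank_eq_zero (k := k) ht]) w (by simp [hwn])
  obtain ⟨b', hb'⟩ := hb.exists_right_inv
  -- Iterating `A = k + tA` with `t = w b'` gives `A = im F + w ^ i A`; for `i = dim A` the last
  -- term vanishes.
  have h1 : ∀ i : ℕ, ∀ a : A, ∃ f ∈ F.range, ∃ r, a = f + w ^ i * r := by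
    intro i
    induction i with
    | zero => exact fun a => ⟨0, zero_mem _, a, by simp⟩
    | succ i ih =>
      intro a
      obtain ⟨f, hf, r, rfl⟩ := ih a
      obtain ⟨c, s, rfl⟩ := exists_eq_algebraMap_add_mul hgen r
      refine ⟨f + w ^ i * algebraMap k A c, add_mem hf (mul_mem (pow_mem (show w ∈ F.range from ⟨t, hF⟩) _)
        (Subalgebra.algebraMap_mem _ _)), b' * s, ?_⟩
      have h3 : t = w * b' := by rw [hw, mul_assoc, hb', mul_one]
      calc _ = f + w ^ i * algebraMap k A c + w ^ i * (t * s) := by ring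
        _ = _ := by rw [h3]; ring
  have hsurj : Function.Surjective F := fun a => by
    obtain ⟨f, ⟨z, hz⟩, r, rfl⟩ := h1 (Module.finrank k A) a
    exact ⟨z, by rw [hwn, zero_mul, add_zero]; exact hz⟩
  have hinj : Function.Injective F :=
    (LinearMap.injective_iff_surjective (f := F.toLinearMap)).mpr hsurj
  exact ⟨AlgEquiv.ofBijective F ⟨hinj, hsurj⟩, hF⟩

/-- The derivation with a given value on the generator. -/
lemma exists_derivation [FiniteDimensional k A] {w : A}
    (hw : (Module.finrank k A : A) * (t ^ (Module.finrank k A - 1) * w) = 0) :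
    ∃ D : Module.End k A, (∀ a b, D (a * b) = D a * b + a * D b) ∧ D t = w := by
  set m := Module.finrank k A with hm
  have htm : t ^ m = 0 := pow_finrank_eq_zero ht
  -- A derivation `D` is an algebra map `a ↦ a + ε D(a)` to the dual numbers over `A`. The relation
  -- `t ^ m = 0` is respected exactly when `m t ^ (m - 1) w = 0`.
  obtain ⟨F, hF⟩ := Algebra.exists_algHom_of_adjoin_eq_top hgen
    (monic_X_pow m) (natDegree_X_pow _) (by simp [htm])
    (C := TrivSqZeroExt A A) (TrivSqZeroExt.inl t + TrivSqZeroExt.inr w) (by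
      rw [map_pow, aeval_X]
      ext
      · simp [htm]
      · rw [TrivSqZeroExt.snd_pow]
        simpa using hw)
  have hfst : ∀ a, (F a).fst = a := fun a =>
    DFunLike.congr_fun (Algebra.algHom_ext_of_adjoin_eq_top hgen
      (F := (TrivSqZeroExt.fstHom k A A).comp F) (F' := AlgHom.id k A) (by simp [hF])) a
  refine ⟨{ toFun := fun a => (F a).snd
            map_add' := fun a b => by simp
            map_smul' := fun c a => by simp }, fun a b => ?_, ?_⟩
  · simp [hfst]
    ring
  · simp [hF]

/-- A derivation with `D(t) = t + 1` exists only if the characteristic divides `dim A`. -/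
lemma dvd_finrank_of_derivation [FiniteDimensional k A] [Nontrivial A] {p : ℕ} [CharP k p]
    {D : Module.End k A} (hD : ∀ a b, D (a * b) = D a * b + a * D b) (h : D t = t + 1) :
    p ∣ Module.finrank k A := by
  set m := Module.finrank k A with hm
  have hm0 : 0 < m := Module.finrank_pos
  have hne : t ^ (m - 1) ≠ 0 := fun h0 => by
    have := finrank_le_of_pow_eq_zero hgen h0
    omega
  have h1 := derivation_pow hD t m
  rw [pow_finrank_eq_zero ht, map_zero, h] at h1
  have hu : IsUnit (t + 1) := ht.isUnit_add_one
  have h2 : (m : A) * t ^ (m - 1) = 0 := hu.mul_left_eq_zero.mp h1.symm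
  have h3 : (m : k) • t ^ (m - 1) = 0 := by rw [Algebra.smul_def, map_natCast, h2]
  rw [smul_eq_zero] at h3
  exact (CharP.cast_eq_zero_iff k p m).mp (h3.resolve_right hne)

/-- Normal forms of derivations `D` with `D ^ (p ^ n) = D`. -/
theorem derivation_normal_form [IsAlgClosed k] [FiniteDimensional k A] [Nontrivial A]
    {p : ℕ} [Fact p.Prime] [CharP k p] {n : ℕ} (hn : n ≠ 0)
    {D : Module.End k A} (hD : ∀ a b, D (a * b) = D a * b + a * D b) (hq : D ^ p ^ n = D) :
    ∃ (c : k) (φ : A ≃ₐ[k] A), c ≠ 0 ∧ c ^ p ^ n = c ∧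
      (D (φ t) = 0 ∨ D (φ t) = c • φ t ∨ D (φ t) = c • (φ t + 1)) := by
  have hD1 : D 1 = 0 := by simpa using hD 1 1
  have hDc : ∀ c : k, D (algebraMap k A c) = 0 := fun c => by
    rw [Algebra.algebraMap_eq_smul_one, map_smul, hD1, smul_zero]
  -- `D` is a root of the separable polynomial `X ^ q - X`, hence semisimple, and `k` is
  -- algebraically closed.
  have htop : ⨆ μ, Module.End.eigenspace D μ = ⊤ := by
    have hss : D.IsSemisimple := by
      refine Module.End.isSemisimple_of_squarefree_aeval_eq_zero (p := X ^ p ^ n - X)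
        (galois_poly_separable p _ (dvd_pow_self p hn)).squarefree ?_
      simp [hq]
    rw [← Module.End.iSup_maxGenEigenspace_eq_top D]
    exact iSup_congr fun μ => (hss.isFinitelySemisimple.maxGenEigenspace_eq_eigenspace μ).symm
  have hspan : ∀ V : Submodule k A, (∀ (μ : k) v, D v = μ • v → v ∈ V) → ∀ a, a ∈ V := by
    intro V hV a
    have : ⨆ μ, Module.End.eigenspace D μ ≤ V :=
      iSup_le fun μ v hv => hV μ v (Module.End.mem_eigenspace_iff.mp hv)
    exact this (htop ▸ Submodule.mem_top)
  have heig : ∀ (μ : k) v, D v = μ • v → v ≠ 0 → μ ^ p ^ n = μ := by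
    intro μ v hv hv0
    have h1 : ∀ m : ℕ, (D ^ m) v = μ ^ m • v := by
      intro m
      induction m with
      | zero => simp
      | succ m ih => rw [pow_succ', Module.End.mul_apply, ih, map_smul, hv, smul_smul, pow_succ]
    have h2 := h1 (p ^ n)
    rw [hq, hv] at h2
    exact (smul_left_injective k hv0 h2).symm
  by_cases hcase : ∃ (v : A) (μ : k), D v = μ • v ∧ μ ≠ 0 ∧ IsUnit v
  · obtain ⟨v, μ, hv, hμ, hu⟩ := hcase
    obtain ⟨c, b, rfl⟩ := exists_eq_algebraMap_add_mul hgen v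
    have hc : c ≠ 0 := by
      rintro rfl
      rw [map_zero, zero_add] at hu
      exact (isNilpotent_mul_left ht b).not_isUnit hu
    -- Dividing the unit eigenvector by its constant term gives `1 + s` with `s = t (c⁻¹ b)`.
    have hs : D (t * (c⁻¹ • b)) = μ • (t * (c⁻¹ • b) + 1) := by
      rw [map_add, hDc, zero_add] at hv
      rw [mul_smul_comm, map_smul, hv, smul_comm, smul_add, inv_smul_eq_iff₀ hc |>.mpr
        (Algebra.algebraMap_eq_smul_one c), add_comm]
    obtain ⟨c₁, b₁, hb₁⟩ := exists_eq_algebraMap_add_mul hgen (c⁻¹ • b)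
    -- If `s` were in `t²A`, the Leibniz rule would put `D s` in `tA`, whereas `μ (s + 1)` has
    -- constant term `μ ≠ 0`.
    have hc₁ : c₁ ≠ 0 := by
      rintro rfl
      rw [hb₁, map_zero, zero_add, hD, hD] at hs
      refine hμ (eq_zero_of_algebraMap_add_mul (k := k) ht (c := μ) (b := μ • (t * b₁))
        (b' := D t * b₁ + (D t * b₁ + t * D b₁)) ?_)
      rw [smul_add, ← Algebra.algebraMap_eq_smul_one, ← mul_smul_comm] at hs
      linear_combination -hs
    obtain ⟨φ, hφ⟩ := exists_algEquiv hgen ht (w := t * (c⁻¹ • b)) rfl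
      (hb₁ ▸ isUnit_algebraMap_add_mul ht hc₁ b₁)
    exact ⟨μ, φ, hμ, heig μ _ hv hu.ne_zero, Or.inr (Or.inr (by rw [hφ, hs]))⟩
  -- In this case every eigenvector with nonzero eigenvalue is a nonunit, so it lies in `tA`; the
  -- others are killed by `D`.
  · have hDt : ∀ a, ∃ b, D a = t * b := by
      let V : Submodule k A := (LinearMap.range (LinearMap.mulLeft k t)).comap D
      have : ∀ a, a ∈ V := hspan V fun μ v hv => by
        change D v ∈ LinearMap.range _
        rw [hv]
        by_cases hμ : μ = 0
        · rw [hμ, zero_smul]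
          exact zero_mem _
        · obtain ⟨c, b, rfl⟩ := exists_eq_algebraMap_add_mul hgen v
          by_cases hc : c = 0
          · rw [hc, map_zero, zero_add]
            exact Submodule.smul_mem _ _ ⟨b, rfl⟩
          · exact absurd ⟨_, μ, hv, hμ, isUnit_algebraMap_add_mul ht hc b⟩ hcase
      intro a
      obtain ⟨b, hb⟩ := this a
      exact ⟨b, hb.symm⟩
    by_cases ht0 : t = 0
    · exact ⟨1, AlgEquiv.refl, one_ne_zero, one_pow _, Or.inl (by simp [ht0])⟩
    -- `V = k + t²A` does not contain `t ≠ 0`, so some eigenvector lies outside `V`: its linear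
    -- coefficient is nonzero and its part in `tA` is a generator.
    let V : Submodule k A :=
      LinearMap.range (Algebra.linearMap k A) ⊔ LinearMap.range (LinearMap.mulLeft k (t * t))
    have hV : ∀ (c : k) (b : A), algebraMap k A c + t * (t * b) ∈ V := fun c b =>
      Submodule.add_mem_sup ⟨c, rfl⟩ ⟨b, by simp⟩
    have hex : ∃ (μ : k) (v : A), D v = μ • v ∧ v ∉ V := by
      by_contra! hcon
      have h1 := hspan V hcon t
      obtain ⟨_, ⟨c, rfl⟩, _, ⟨b, rfl⟩, h2⟩ := Submodule.mem_sup.mp h1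
      simp only [Algebra.linearMap_apply, LinearMap.mulLeft_apply] at h2
      have hc := eq_zero_of_algebraMap_add_mul (k := k) ht (c := c) (b := t * b) (b' := 1) (by
        linear_combination h2)
      rw [hc, map_zero, zero_add] at h2
      have h3 : t * (1 + t * (-b)) = 0 := by linear_combination -h2
      have h4 : IsUnit (1 + t * (-b)) := by
        have := isUnit_algebraMap_add_mul (k := k) ht one_ne_zero (-b)
        rwa [map_one] at this
      exact ht0 (h4.mul_left_eq_zero.mp h3)
    obtain ⟨μ, v, hv, hvV⟩ := hex
    obtain ⟨c₀, b₀, rfl⟩ := exists_eq_algebraMap_add_mul hgen v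
    obtain ⟨c₁, b₁, hb₁⟩ := exists_eq_algebraMap_add_mul hgen b₀
    have hc₁ : c₁ ≠ 0 := by
      rintro rfl
      apply hvV
      rw [hb₁, map_zero, zero_add]
      exact hV c₀ b₁
    obtain ⟨φ, hφ⟩ := exists_algEquiv hgen ht (w := t * b₀) rfl
      (hb₁ ▸ isUnit_algebraMap_add_mul ht hc₁ b₁)
    have hv0 : algebraMap k A c₀ + t * b₀ ≠ 0 := fun h => hvV (h ▸ V.zero_mem)
    have hμq := heig μ _ hv hv0
    rw [map_add, hDc, zero_add] at hv
    by_cases hμ : μ = 0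
    · exact ⟨1, φ, one_ne_zero, one_pow _, Or.inl (by rw [hφ, hv, hμ, zero_smul])⟩
    · obtain ⟨b, hb⟩ := hDt (t * b₀)
      -- For `μ ≠ 0` the eigenvector is `μ⁻¹` times its image under `D`, so it lies in `tA`.
      have hc₀ : c₀ = 0 := by
        have h1 : algebraMap k A c₀ + t * b₀ = t * (μ⁻¹ • b) := by
          rw [mul_smul_comm, ← hb, hv, inv_smul_smul₀ hμ]
        exact eq_zero_of_algebraMap_add_mul ht h1
      refine ⟨μ, φ, hμ, hμq, Or.inr (Or.inl ?_)⟩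
      rw [hφ, hv, hc₀, map_zero, zero_add]

end NilpotentGenerator

/-! ## Twist equivalent smash products have conjugate actions -/

section TwistInvariants

variable {k : Type*} [Field k] {H : Type*} [Ring H] [HopfAlgebra k H]
  {A : Type*} [CommRing A] [Algebra k A]

lemma IsPrimitiveElement.map {z : H} (hz : IsPrimitiveElement k z) (ψ : H ≃ₐc[k] H) :
    IsPrimitiveElement k (ψ z) := by
  have h := CoalgHomClass.map_comp_comul_apply ψ z
  rw [hz] at h
  unfold IsPrimitiveElement
  rw [← h]
  simp

/-- For primitive `z`, the elements `f(1 # ψ z)` and `1 # z` have the same coaction defect `1 ⊗ z`,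
so they differ by an element of `A`. As `A` is commutative, both have the same commutators with `A`,
and these commutators are the actions. -/
theorem TwistEquivalent.exists_conj {S₀ S₁ : ModuleAlgebra k H A}
    (h : TwistEquivalent (SmashProduct.incl S₀) (SmashProduct.coaction S₀)
      (SmashProduct.incl S₁) (SmashProduct.coaction S₁)) :
    ∃ (φ : A ≃ₐ[k] A) (ψ : H ≃ₐc[k] H), ∀ z, IsPrimitiveElement k z → ∀ a,
      S₁.act z (φ a) = φ (S₀.act (ψ z) a) := by
  obtain ⟨φ, ψ, f, hf, hfρ⟩ := h
  refine ⟨φ, ψ, fun z hz a => ?_⟩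
  have hfι : ∀ a, f (SmashProduct.incl S₀ a) = SmashProduct.incl S₁ (φ a) := fun a => by
    simpa using hf a 1
  have hψz := hz.map ψ
  have hinj : Function.Injective ((ψ : H →ₗ[k] H).lTensor (SmashProduct S₁)) :=
    (TensorProduct.congr (LinearEquiv.refl k (SmashProduct S₁))
      (ψ : H ≃ₐ[k] H).toLinearEquiv).injective
  have hρ : SmashProduct.coaction S₁ (f (SmashProduct.inclH S₀ (ψ z))) =
      f (SmashProduct.inclH S₀ (ψ z)) ⊗ₜ 1 + 1 ⊗ₜ z := by
    apply hinj
    rw [hfρ, SmashProduct.coaction_inclH S₀ hψz]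
    simp
  obtain ⟨a₀, ha₀⟩ : f (SmashProduct.inclH S₀ (ψ z)) - SmashProduct.inclH S₁ z ∈
      Set.range (SmashProduct.incl S₁) := by
    rw [← (SmashProduct.isCleftExtension S₁).coinvariants, map_sub, hρ,
      SmashProduct.coaction_inclH S₁ hz, TensorProduct.sub_tmul]
    abel
  have h1 := congrArg f (SmashProduct.inclH_mul_incl S₀ hψz a)
  rw [map_mul, map_add, map_mul, hfι, hfι, eq_add_of_sub_eq ha₀.symm, add_mul, mul_add,
    SmashProduct.inclH_mul_incl S₁ hz, ← map_mul, ← map_mul, mul_comm a₀] at h1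
  apply (SmashProduct.isCleftExtension S₁).injective
  have h2 := sub_eq_zero.mpr h1
  rw [← sub_eq_zero, ← h2]
  abel

end TwistInvariants

/-! ### Normal forms of cleft extensions and their inequivalence -/

section SmashProductClassification

variable {p : ℕ} [Fact p.Prime] {n : ℕ} {k : Type u} [Field k]
  {A : Type v} [CommRing A] [Algebra k A] [FiniteDimensional k A] [IsLocalRing A]

lemma isPrimitiveGenerator_dualGroupAlgebra (hn : n ≠ 0) {x : DualGroupAlgebra k p n}
    (hx : IsPrimitiveElement k x) (hgen : Algebra.adjoin k {x} = ⊤) (hpow : x ^ p ^ n = x) :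
    IsPrimitiveGenerator k (p ^ n) x :=
  ⟨hx, hgen, hpow, DualGroupAlgebra.finrank_eq p n k,
    Nat.one_lt_pow hn (Fact.out : p.Prime).one_lt⟩

/-- Every cleft extension of a local algebra is a smash product up to twist equivalence. -/
theorem IsCleftExtension.exists_twistEquivalent [IsAlgClosed k] [CharP k p] (hn : n ≠ 0)
    {x : DualGroupAlgebra k p n} (hx : IsPrimitiveGenerator k (p ^ n) x) {B : Type w} [Ring B]
    [Algebra k B] {ι : A →ₐ[k] B} {ρ : B →ₐ[k] B ⊗[k] DualGroupAlgebra k p n}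
    (hB : IsCleftExtension ι ρ) : ∃ S : ModuleAlgebra k (DualGroupAlgebra k p n) A,
      TwistEquivalent ι ρ (SmashProduct.incl S) (SmashProduct.coaction S) := by
  obtain ⟨y, hy, hypow⟩ := hB.exists_coaction_eq_pow_eq hn hx.primitive hx.pow_eq
  obtain ⟨D, hD, hLeib, hDpow⟩ := hB.exists_derivation hy hypow
  obtain ⟨S, hS⟩ := hx.exists_moduleAlgebra D hLeib hDpow
  refine ⟨S, hB.twistEquivalent hx hy hypow (one_pow _) one_ne_zero AlgEquiv.refl S fun a => ?_⟩
  rw [hS, one_smul]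
  exact (hD a).symm

/-- The normal forms of cleft extensions of a local algebra with a nilpotent generator. -/
theorem IsCleftExtension.exists_twistEquivalent_normal_form [IsAlgClosed k] [CharP k p] (hn : n ≠ 0)
    {x : DualGroupAlgebra k p n} (hx : IsPrimitiveGenerator k (p ^ n) x) {t : A}
    (ht : IsNilpotent t) (hgen : Algebra.adjoin k {t} = ⊤) {B : Type w} [Ring B]
    [Algebra k B] {ι : A →ₐ[k] B} {ρ : B →ₐ[k] B ⊗[k] DualGroupAlgebra k p n}
    (hB : IsCleftExtension ι ρ) : ∃ S : ModuleAlgebra k (DualGroupAlgebra k p n) A,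
      (S.act x t = 0 ∨ S.act x t = t ∨ S.act x t = t + 1) ∧
      TwistEquivalent ι ρ (SmashProduct.incl S) (SmashProduct.coaction S) := by
  obtain ⟨y, hy, hypow⟩ := hB.exists_coaction_eq_pow_eq hn hx.primitive hx.pow_eq
  obtain ⟨D, hD, hLeib, hDpow⟩ := hB.exists_derivation hy hypow
  obtain ⟨c, φ, hc0, hc, hnf⟩ := derivation_normal_form hgen ht hn hLeib hDpow
  -- Conjugating by `φ` moves the normal form from `φ t` to `t`, and `c⁻¹` normalises the
  -- eigenvalue; `c ^ q = c` preserves the condition on the `q`-th power.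
  let D' : Module.End k A :=
    c⁻¹ • (φ.symm.toLinearEquiv.toLinearMap ∘ₗ D ∘ₗ φ.toLinearEquiv.toLinearMap)
  have hD' : ∀ a, D' a = c⁻¹ • φ.symm (D (φ a)) := fun _ => rfl
  have hpow : ∀ m a, (D' ^ m) a = c⁻¹ ^ m • φ.symm ((D ^ m) (φ a)) := by
    intro m
    induction m with
    | zero => simp
    | succ m ih =>
      intro a
      rw [pow_succ', Module.End.mul_apply, ih, hD', map_smul, AlgEquiv.apply_symm_apply,
        map_smul, map_smul, smul_smul, pow_succ', pow_succ', Module.End.mul_apply]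
  obtain ⟨S, hS⟩ := hx.exists_moduleAlgebra D' (fun a b => by
      rw [hD', hD', hD', map_mul, hLeib, map_add, map_mul, map_mul, AlgEquiv.symm_apply_apply,
        AlgEquiv.symm_apply_apply, smul_add, smul_mul_assoc, mul_smul_comm])
    (by
      ext a
      rw [hpow, hDpow, inv_pow, hc, hD'])
  refine ⟨S, ?_, hB.twistEquivalent hx hy hypow hc hc0 φ.symm S fun a => ?_⟩
  · rw [hS, hD']
    rcases hnf with h | h | h
    · left
      rw [h, map_zero, smul_zero]
    · right; left
      rw [h, map_smul, AlgEquiv.symm_apply_apply, inv_smul_smul₀ hc0]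
    · right; right
      rw [h, map_smul, map_add, AlgEquiv.symm_apply_apply, map_one, inv_smul_smul₀ hc0]
  · rw [AlgEquiv.symm_symm, hS, hD', map_smul, AlgEquiv.apply_symm_apply, ← map_smul,
      smul_inv_smul₀ hc0, hD]

variable {H : Type*} [Ring H] [HopfAlgebra k H] {x : H} (hx : IsPrimitiveGenerator k (p ^ n) x)
  {t : A} (ht : IsNilpotent t) (hgen : Algebra.adjoin k {t} = ⊤)

omit [Fact p.Prime] [FiniteDimensional k A] [IsLocalRing A] in
include hx hgen in
lemma moduleAlgebra_ext_of_generator {S S' : ModuleAlgebra k H A} (h : S.act x t = S'.act x t) :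
    S = S' :=
  hx.moduleAlgebra_ext
    (derivation_ext hgen (hx.primitive.act_mul S) (hx.primitive.act_mul S') h)

include hx hgen in
omit [IsLocalRing A] [FiniteDimensional k A] [Fact p.Prime] in
lemma existsUnique_moduleAlgebra {w : A} {D : Module.End k A}
    (hD : ∀ a b, D (a * b) = D a * b + a * D b) (hw : D t = w) (hpow : D ^ p ^ n = D) :
    ∃! S : ModuleAlgebra k H A, S.act x t = w := by
  obtain ⟨S, hS⟩ := hx.exists_moduleAlgebra D hD hpow
  have hSw : S.act x t = w := by rw [hS, hw]
  exact ⟨S, hSw, fun S' hS' => moduleAlgebra_ext_of_generator hx hgen (hS'.trans hSw.symm)⟩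

include ht hgen in
omit [FiniteDimensional k A] [Fact p.Prime] in
/-- An action preserving the maximal ideal is not twist equivalent to one that does not. -/
lemma not_twistEquivalent_of_act_eq_add_one {S₀ S₁ : ModuleAlgebra k H A}
    (hx : IsPrimitiveGenerator k (p ^ n) x) (h₀ : S₀.act x t = t) (h₁ : S₁.act x t = t + 1) :
    ¬ TwistEquivalent (SmashProduct.incl S₀) (SmashProduct.coaction S₀)
      (SmashProduct.incl S₁) (SmashProduct.coaction S₁) := by
  intro h
  obtain ⟨φ, ψ, hφ⟩ := h.exists_conj
  have h2 := hφ x hx.primitive (φ.symm t)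
  rw [AlgEquiv.apply_symm_apply, h₁] at h2
  obtain ⟨c, b, hb⟩ := exists_eq_algebraMap_add_mul hgen (φ.symm t)
  have hmem : φ.symm t ∈ LinearMap.range (LinearMap.mulLeft k t) := by
    have hc : c = 0 := by
      by_contra hc
      have hu := isUnit_algebraMap_add_mul ht hc b
      rw [← hb] at hu
      exact (ht.map φ.symm).not_isUnit hu
    rw [hb, hc, map_zero, zero_add]
    exact ⟨b, rfl⟩
  -- Nothing is known about `ψ x` beyond its membership in `H`, so stability of `tA` is needed under
  -- all of `H`. It makes `t + 1` the image under `φ` of an element of `tA`, hence nilpotent.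
  obtain ⟨b', hb'⟩ := hx.act_mem S₀ (LinearMap.range (LinearMap.mulLeft k t)) (by
    rintro _ ⟨b, rfl⟩
    exact ⟨b + S₀.act x b, by
      rw [LinearMap.mulLeft_apply, LinearMap.mulLeft_apply, hx.primitive.act_mul, h₀, mul_add]⟩)
    (ψ x) _ hmem
  have hnil : IsNilpotent (t + 1) := by
    rw [h2, ← hb']
    exact (isNilpotent_mul_left ht b').map φ
  exact hnil.not_isUnit ht.isUnit_add_one

omit [FiniteDimensional k A] [IsLocalRing A] [Fact p.Prime] in
include hx in
/-- The trivial action is not twist equivalent to a nontrivial one. -/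
lemma act_eq_zero_of_twistEquivalent {S₀ S₁ : ModuleAlgebra k H A} (h₀ : S₀.act x = 0)
    (h : TwistEquivalent (SmashProduct.incl S₀) (SmashProduct.coaction S₀)
      (SmashProduct.incl S₁) (SmashProduct.coaction S₁)) : S₁.act x = 0 := by
  obtain ⟨φ, ψ, hφ⟩ := h.exists_conj
  ext a
  have h2 := hφ x hx.primitive (φ.symm a)
  rw [AlgEquiv.apply_symm_apply, hx.act_eq_counit_smul S₀ h₀,
    (hx.primitive.map ψ).counit_eq_zero, zero_smul, map_zero] at h2
  exact h2

omit [Fact p.Prime] [FiniteDimensional k A] [IsLocalRing A] in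
include hgen in
lemma ne_zero_of_one_lt_finrank (h : 1 < Module.finrank k A) : t ≠ 0 := by
  rintro rfl
  refine absurd (finrank_le_one (1 : A) fun a => ?_) (not_le.mpr h)
  obtain ⟨c, b, rfl⟩ := exists_eq_algebraMap_add_mul hgen a
  exact ⟨c, by rw [zero_mul, add_zero, Algebra.algebraMap_eq_smul_one]⟩

end SmashProductClassification

end

theorem mainTheorem10
    (p : ℕ) [Fact p.Prime] (n : ℕ) (hn : 0 < n)
    (k : Type u) [Field k] [IsAlgClosed k] [CharP k p]
    (A : Type v) [CommRing A] [Algebra k A] [FiniteDimensional k A] [IsLocalRing A] :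
    -- every cleft extension of `A` is twist equivalent to a smash product
    (∀ (B : Type w) [Ring B] [Algebra k B] (ι : A →ₐ[k] B)
        (ρ : B →ₐ[k] B ⊗[k] DualGroupAlgebra k p n), IsCleftExtension ι ρ →
      ∃ S : ModuleAlgebra k (DualGroupAlgebra k p n) A,
        TwistEquivalent ι ρ (SmashProduct.incl S) (SmashProduct.coaction S)) ∧
    -- `H` has a primitive generator `x` with `x ^ (p ^ n) = x`
    (∃ x : DualGroupAlgebra k p n, IsPrimitiveElement k x ∧
      Algebra.adjoin k {x} = ⊤ ∧ x ^ p ^ n = x) ∧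
    -- the classification, for any such `x` and any nilpotent generator `t` of `A`
    (∀ x : DualGroupAlgebra k p n, IsPrimitiveElement k x →
      Algebra.adjoin k {x} = ⊤ → x ^ p ^ n = x →
      ∀ t : A, IsNilpotent t → Algebra.adjoin k {t} = ⊤ →
      -- the three actions exist, the last one exactly when `p ∣ dim A`
      (∃! S : ModuleAlgebra k (DualGroupAlgebra k p n) A, S.act x t = 0) ∧
      (∃! S : ModuleAlgebra k (DualGroupAlgebra k p n) A, S.act x t = t) ∧
      (p ∣ Module.finrank k A →
        ∃! S : ModuleAlgebra k (DualGroupAlgebra k p n) A, S.act x t = t + 1) ∧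
      ((∃ S : ModuleAlgebra k (DualGroupAlgebra k p n) A, S.act x t = t + 1) →
        p ∣ Module.finrank k A) ∧
      -- every cleft extension is twist equivalent to one of the three smash products
      (∀ (B : Type w) [Ring B] [Algebra k B] (ι : A →ₐ[k] B)
          (ρ : B →ₐ[k] B ⊗[k] DualGroupAlgebra k p n), IsCleftExtension ι ρ →
        ∃ S : ModuleAlgebra k (DualGroupAlgebra k p n) A,
          (S.act x t = 0 ∨ S.act x t = t ∨ S.act x t = t + 1) ∧
          TwistEquivalent ι ρ (SmashProduct.incl S) (SmashProduct.coaction S)) ∧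
      -- they are pairwise not twist equivalent, unless `A = k` where the first two coincide
      (1 < Module.finrank k A →
        ∀ S₀ S₁ : ModuleAlgebra k (DualGroupAlgebra k p n) A,
          ((S₀.act x t = 0 ∧ S₁.act x t = t) ∨ (S₀.act x t = 0 ∧ S₁.act x t = t + 1) ∨
            (S₀.act x t = t ∧ S₁.act x t = t + 1)) →
          ¬ TwistEquivalent (SmashProduct.incl S₀) (SmashProduct.coaction S₀)
              (SmashProduct.incl S₁) (SmashProduct.coaction S₁))) := by
  have hn0 : n ≠ 0 := hn.ne'
  refine ⟨fun B _ _ ι ρ hB => ?_, exists_primitive_generator p n k hn0, ?_⟩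
  · obtain ⟨x, hx, hgen, hpow⟩ := exists_primitive_generator p n k hn0
    exact hB.exists_twistEquivalent hn0 (isPrimitiveGenerator_dualGroupAlgebra hn0 hx hgen hpow)
  intro x hxp hxgen hxpow t ht hgen
  have hx := isPrimitiveGenerator_dualGroupAlgebra hn0 hxp hxgen hxpow
  have hzero : ∀ S : ModuleAlgebra k (DualGroupAlgebra k p n) A, S.act x t = 0 → S.act x = 0 :=
    fun S hS => derivation_ext hgen (hxp.act_mul S) (D' := 0) (by simp) (by simpa using hS)
  refine ⟨?_, ?_, fun hdvd => ?_, ?_, fun B _ _ ι ρ hB => ?_, ?_⟩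
  · refine existsUnique_moduleAlgebra hx hgen (D := 0) (by simp) (by simp) ?_
    exact zero_pow (by have := hx.one_lt; omega)
  · obtain ⟨D, hD, hDt⟩ := exists_derivation hgen ht (w := t) (by
      rw [← pow_succ, Nat.sub_add_cancel Module.finrank_pos, pow_finrank_eq_zero ht, mul_zero])
    exact existsUnique_moduleAlgebra hx hgen hD hDt (derivation_pow_char_eq n hgen hD hDt)
  · have hfr : ((Module.finrank k A : ℕ) : A) = 0 := by
      rw [← map_natCast (algebraMap k A), (CharP.cast_eq_zero_iff k p _).mpr hdvd, map_zero]
    -- The obstruction `m t ^ (m - 1) w` vanishes since `m = 0` in `A`. The generator `t + 1` then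
    -- satisfies `D (t + 1) = t + 1`, which gives `D ^ q = D` as in case (b).
    obtain ⟨D, hD, hDt⟩ := exists_derivation hgen ht (w := t + 1) (by rw [hfr, zero_mul])
    refine existsUnique_moduleAlgebra hx hgen hD hDt
      (derivation_pow_char_eq n (adjoin_add_one_eq_top hgen) hD ?_)
    have hD1 : D 1 = 0 := by simpa using hD 1 1
    rw [map_add, hDt, hD1, add_zero]
  · rintro ⟨S, hS⟩
    exact dvd_finrank_of_derivation hgen ht (hxp.act_mul S) hS
  · exact hB.exists_twistEquivalent_normal_form hn0 hx ht hgen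
  · rintro hdim S₀ S₁ (⟨h₀, h₁⟩ | ⟨h₀, h₁⟩ | ⟨h₀, h₁⟩) h
    · rw [act_eq_zero_of_twistEquivalent hx (hzero S₀ h₀) h] at h₁
      exact ne_zero_of_one_lt_finrank hgen hdim h₁.symm
    · rw [act_eq_zero_of_twistEquivalent hx (hzero S₀ h₀) h] at h₁
      have hu : IsUnit (t + 1) := ht.isUnit_add_one
      rw [← h₁] at hu
      exact not_isUnit_zero hu
    · exact not_twistEquivalent_of_act_eq_add_one ht hgen hx h₀ h₁ h
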